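/- Let $D$ be a finitely generated abelian group and $S=\bigoplus_{d\in D}S_d$ a $D$-graded integral domain such that $D$ is generated by $\{d : S_d\neq 0\}$. Assume that $S$ is factorially $D$-graded: every nonzero homogeneous nonunit is a product of $D$-prime elements, where a nonzero homogeneous nonunit $p$ is $D$-prime if $p\mid gh$ with $g,h$ homogeneous implies $p\mid g$ or $p\mid h$. Definitions. A homogeneous $f\in S$ is relevant if the degrees of the homogeneous units of $S_f$ form a subgroup of finite index in $D$; $S_+$ is the ideal generated by all relevant elements; $S_{(f)}$ is the degree-zero part of $S_f$. A proper homogeneous ideal $\mathfrak p$ is $D$-prime if $gh\in\mathfrak p$ with $g,h$ homogeneous implies $g\in\mathfrak p$ or $h\in\mathfrak p$. $D\text{-}\mathrm{Spec}(S)$ is the set of $D$-prime ideals, with closed sets $V(E)=\{\mathfrak p: E\subseteq\mathfrak p\}$ for sets $E$ of homogeneous elements; $\mathrm{Proj}_D(S)=\{\mathfrak p: S_+\not\subseteq\mathfrak p\}$ is an open subspace; $D_+(h)=\{\mathfrak p\in\mathrm{Proj}_D(S): h\notin\mathfrak p\}$. Let $\pi:\mathrm{Spec}(S)\to Q(S)$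 be the quotient, in (locally) ringed spaces, by the action of $\mathrm{Spec}(S_0[D])$ given by the grading, and let $\mathrm{Proj}^D(S)\subseteq Q(S)$ be the open subspace $\bigcup_{f\text{ relevant}}\pi(\{P: f\notin P\})$. Let $\theta:Q(S)\to D\text{-}\mathrm{Spec}(S)$ be the continuous map sending $\pi(P)$ to the ideal generated by the homogeneous elements of $P$; $D\text{-}\mathrm{Spec}(S)$ carries the sheaf $\theta_*\mathcal O_{Q(S)}$, and $\mathrm{Proj}_D(S)$ its restriction. Then $\theta$ restricts to an isomorphism of ringed spaces $\mathrm{Proj}^D(S)\cong\mathrm{Proj}_D(S)$, and the following hold. (a) If $D$ is finite or $1$ is relevant, then $\mathrm{Proj}^D(S)=\mathrm{Spec}(S_0)=\mathrm{Proj}_D(S)=D\text{-}\mathrm{Spec}(S)$. That is: the canonical morphism $\mathrm{Proj}^D(S)\subseteq Q(S)\to\mathrm{Spec}(S_0)$ is an isomorphism, every $D$-prime ideal lies in $\mathrm{Proj}_D(S)$, and $\mathfrak p\mapsto\mathfrak p\cap S_0$ underlies an isomorphism of ringed spaces $D\text{-}\mathrm{Spec}(S)\cong\mathrm{Spec}(S_0)$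 which, composed with $\theta$, is the canonical morphism $Q(S)\to\mathrm{Spec}(S_0)$. (b) $\mathrm{Proj}^D(S)$ is a scheme. For relevant $f$ there is an open immersion $\mathrm{Spec}(S_{(f)})\to\mathrm{Proj}^D(S)$ compatible with $\mathrm{Spec}(S_f)\to\mathrm{Spec}(S_{(f)})$ and $\mathrm{Spec}(S_f)\to\mathrm{Spec}(S)\to Q(S)$, with image $\pi(\{P: f\notin P\})$. Composed with $\theta$ it is a bijection onto $D_+(f)$ with inverse $\mathfrak p\mapsto\mathfrak pS_f\cap S_{(f)}$. For relevant $f,g$ the product $fg$ is relevant and, as open subsets of $\mathrm{Proj}^D(S)$, $$\mathrm{Spec}(S_{(f)})\cap\mathrm{Spec}(S_{(g)})=\mathrm{Spec}(S_{(fg)}).$$ In particular $\mathrm{Proj}^D(S)$ is glued from the $D_+(f)\cong\mathrm{Spec}(S_{(f)})$ along $D_+(f)\cap D_+(g)=D_+(fg)$: these open subschemes cover it, and $\mathrm{Spec}(S_{(fg)})$, with the canonical maps to $\mathrm{Spec}(S_{(f)})$ and $\mathrm{Spec}(S_{(g)})$, is their fibre product over $\mathrm{Proj}^D(S)$. (c)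 For every homogeneous $h\in S$, $D_+(h)$ is open and $$D_+(h)=\bigcup_{f\text{ relevant},\ h\mid f}D_+(f),$$ and correspondingly $\theta^{-1}(D_+(h))=\bigcup_{f\text{ relevant},\ h\mid f}\mathrm{Spec}(S_{(f)})$ in $\mathrm{Proj}^D(S)$. Moreover, if $G$ is any set of relevant elements generating the ideal $S_+$, then $hf$ is relevant for all $f\in G$ and $D_+(h)=\bigcup_{f\in G}D_+(hf)$. -/

import Mathlib

open CategoryTheory CategoryTheory.Limits AlgebraicGeometry TopologicalSpace

universe u

noncomputable section

namespace MultigradedProj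

variable {D S : Type u} [AddCommGroup D] [DecidableEq D] [CommRing S]
variable (𝒜 : D → AddSubgroup S) [GradedRing 𝒜]

/-! ### Graded algebra -/

/-- The grading is effective: the grading group is generated by the degrees `d` with `S_d ≠ 0`. -/
def IsEffective : Prop :=
  AddSubgroup.closure {d : D | 𝒜 d ≠ ⊥} = ⊤

/-- `D`-prime elements: nonzero homogeneous nonunits that are prime with respect to products
of homogeneous elements. -/
structure IsDPrimeElem (p : S) : Prop where
  homogeneous : SetLike.IsHomogeneousElem 𝒜 p
  ne_zero : p ≠ 0
  not_isUnit : ¬ IsUnit p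
  dvd_or_dvd : ∀ g h : S, SetLike.IsHomogeneousElem 𝒜 g → SetLike.IsHomogeneousElem 𝒜 h →
    p ∣ g * h → p ∣ g ∨ p ∣ h

/-- `S` is factorially graded: every nonzero homogeneous nonunit is a (finite) product of
`D`-prime elements. -/
def IsFactoriallyGraded : Prop :=
  ∀ f : S, SetLike.IsHomogeneousElem 𝒜 f → f ≠ 0 → ¬ IsUnit f →
    ∃ m : Multiset S, (∀ p ∈ m, IsDPrimeElem 𝒜 p) ∧ m.prod = f

/-- The degree `d` part of the localization `S_f` for homogeneous `f`: all fractions `a / f ^ k`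
with `a` homogeneous of degree `d + deg (f ^ k)`. -/
def awayDegree (f : S) (d : D) : Set (Localization.Away f) :=
  {x | ∃ (k : ℕ) (e : D) (a : S), f ^ k ∈ 𝒜 e ∧ a ∈ 𝒜 (d + e) ∧
    x = Localization.mk a (⟨f ^ k, k, rfl⟩ : Submonoid.powers f)}

/-- The support group `D^f`: the group of the degrees of the homogeneous units of `S_f`. -/
def supportGroup (f : S) : AddSubgroup D :=
  AddSubgroup.closure {d : D | ∃ x ∈ awayDegree 𝒜 f d, IsUnit x}

/-- `f` is relevant: `f` is homogeneous and `S_f` is periodic, i.e. the degrees of its homogeneous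
units form a subgroup of finite index in `D`. -/
def IsRelevant (f : S) : Prop :=
  SetLike.IsHomogeneousElem 𝒜 f ∧ (supportGroup 𝒜 f).FiniteIndex

/-- The irrelevant ideal `S_+`, generated by all relevant elements. -/
def irrelevantIdeal : Ideal S := Ideal.span {f | IsRelevant 𝒜 f}

/-! ### The `D`-prime spectrum -/

/-- The `D`-prime spectrum: proper homogeneous ideals that are prime with respect to products of
homogeneous elements. -/
@[ext]
structure DSpec where
  asIdeal : Ideal S
  isHomogeneous : asIdeal.IsHomogeneous 𝒜
  ne_top : asIdeal ≠ ⊤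
  mem_or_mem : ∀ f g : S, SetLike.IsHomogeneousElem 𝒜 f → SetLike.IsHomogeneousElem 𝒜 g →
    f * g ∈ asIdeal → f ∈ asIdeal ∨ g ∈ asIdeal

/-- The `D`-prime ideals that contain a set `E`. -/
def zeroLocus (E : Set S) : Set (DSpec 𝒜) := {p | E ⊆ p.asIdeal}

/-- The homogeneous Zariski topology: the closed sets are the sets of all `D`-prime ideals
containing some set `E` of homogeneous elements. -/
instance : TopologicalSpace (DSpec 𝒜) :=
  TopologicalSpace.ofClosed
    {Z | ∃ E : Set S, (∀ x ∈ E, SetLike.IsHomogeneousElem 𝒜 x) ∧ Z = zeroLocus 𝒜 E}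
    ⟨{1}, by
      rintro x rfl
      exact SetLike.isHomogeneousElem_one 𝒜, by
      ext p
      simpa [zeroLocus] using fun h => p.ne_top ((Ideal.eq_top_iff_one _).2 h)⟩
    (by
      intro A hA
      have hA' : ∀ Z ∈ A, ∃ E : Set S, (∀ x ∈ E, SetLike.IsHomogeneousElem 𝒜 x) ∧
          Z = zeroLocus 𝒜 E := fun Z h => hA h
      choose! E hE hZ using hA'
      refine ⟨⋃ Z ∈ A, E Z, ?_, ?_⟩
      · intro x hx
        simp only [Set.mem_iUnion] at hx
        obtain ⟨Z, hZA, hx⟩ := hx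
        exact hE Z hZA x hx
      · ext p
        simp only [Set.mem_sInter, zeroLocus, Set.mem_ofPred_eq, Set.iUnion_subset_iff]
        refine forall₂_congr fun Z hZA => ?_
        conv_lhs => rw [hZ Z hZA]
        rfl)
    (by
      rintro _ ⟨E, hE, rfl⟩ _ ⟨F, hF, rfl⟩
      refine ⟨{x | ∃ a ∈ E, ∃ b ∈ F, x = a * b}, ?_, ?_⟩
      · rintro _ ⟨a, ha, b, hb, rfl⟩
        exact (hE a ha).mul (hF b hb)
      · ext p
        constructor
        · rintro (h | h) _ ⟨a, ha, b, hb, rfl⟩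
          · exact p.asIdeal.mul_mem_right _ (h ha)
          · exact p.asIdeal.mul_mem_left _ (h hb)
        · intro h
          by_contra hc
          simp only [zeroLocus, Set.mem_union, Set.mem_ofPred_eq, not_or, Set.not_subset] at hc
          obtain ⟨⟨a, ha, ha'⟩, b, hb, hb'⟩ := hc
          exact (p.mem_or_mem a b (hE a ha) (hF b hb) (h ⟨a, ha, b, hb, rfl⟩)).elim ha' hb')

theorem isClosed_zeroLocus {E : Set S} (hE : ∀ x ∈ E, SetLike.IsHomogeneousElem 𝒜 x) :
    IsClosed (zeroLocus 𝒜 E) := by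
  refine ⟨?_⟩
  exact ⟨E, hE, by simp⟩

theorem isClosed_iff_zeroLocus (Z : Set (DSpec 𝒜)) :
    IsClosed Z ↔ ∃ E : Set S, (∀ x ∈ E, SetLike.IsHomogeneousElem 𝒜 x) ∧ Z = zeroLocus 𝒜 E := by
  refine ⟨fun h => ?_, fun ⟨E, hE, h⟩ => h ▸ isClosed_zeroLocus 𝒜 hE⟩
  obtain ⟨E, hE, h⟩ := h.isOpen_compl
  exact ⟨E, hE, by simpa using h⟩

/-- The multihomogeneous `D`-prime spectrum `Proj_D(S)`: the (open) set of all `D`-prime ideals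
that do not contain the irrelevant ideal, with the subspace topology. -/
def projD : Opens (DSpec 𝒜) where
  carrier := {p | ¬ irrelevantIdeal 𝒜 ≤ p.asIdeal}
  is_open' := by
    have h : {p : DSpec 𝒜 | ¬ irrelevantIdeal 𝒜 ≤ p.asIdeal} =
        (zeroLocus 𝒜 {f | IsRelevant 𝒜 f})ᶜ := by
      ext p
      simp [irrelevantIdeal, zeroLocus, Ideal.span_le]
    rw [h]
    exact (isClosed_zeroLocus 𝒜 fun x hx => hx.1).isOpen_compl

/-- `D_+(h)`, the set of all points of `Proj_D(S)` that do not contain `h`. -/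
def dPlus (h : S) : Set (DSpec 𝒜) := {p | p ∈ projD 𝒜 ∧ h ∉ p.asIdeal}

/-- The ideal `𝔭 S_f ∩ S_(f)` of the degree zero localization `S_(f)`. -/
def psiIdeal (f : S) (p : DSpec 𝒜) : Ideal (HomogeneousLocalization.Away 𝒜 f) :=
  (p.asIdeal.map (algebraMap S (Localization.Away f))).comap
    (algebraMap (HomogeneousLocalization.Away 𝒜 f) (Localization.Away f))

/-- The `D`-prime ideal generated by the homogeneous elements of a prime ideal. -/
def homogeneousCore (P : PrimeSpectrum S) : DSpec 𝒜 where
  asIdeal := (P.asIdeal.homogeneousCore 𝒜).toIdeal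
  isHomogeneous := (P.asIdeal.homogeneousCore 𝒜).isHomogeneous
  ne_top h := P.isPrime.ne_top (top_le_iff.1 (h ▸ Ideal.toIdeal_homogeneousCore_le 𝒜 P.asIdeal))
  mem_or_mem _ _ hf hg hfg :=
    (P.isPrime.mem_or_mem (Ideal.toIdeal_homogeneousCore_le 𝒜 P.asIdeal hfg)).imp
      (Ideal.mem_homogeneousCore_of_homogeneous_of_mem hf)
      (Ideal.mem_homogeneousCore_of_homogeneous_of_mem hg)

theorem mem_homogeneousCore {P : PrimeSpectrum S} {x : S} (hx : SetLike.IsHomogeneousElem 𝒜 x) :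
    x ∈ (homogeneousCore 𝒜 P).asIdeal ↔ x ∈ P.asIdeal :=
  ⟨fun h => Ideal.toIdeal_homogeneousCore_le 𝒜 P.asIdeal h,
    Ideal.mem_homogeneousCore_of_homogeneous_of_mem hx⟩

theorem continuous_homogeneousCore : Continuous (homogeneousCore 𝒜) := by
  refine continuous_iff_isClosed.2 fun Z hZ => ?_
  obtain ⟨E, hE, rfl⟩ := (isClosed_iff_zeroLocus 𝒜 Z).1 hZ
  rw [PrimeSpectrum.isClosed_iff_zeroLocus]
  refine ⟨E, ?_⟩
  ext P
  exact forall₂_congr fun x hx => mem_homogeneousCore 𝒜 (hE x hx)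

/-! ### The quotient of `Spec S` by the diagonalizable group `Spec S_0[D]` -/

/-- The coaction `S → S[D]`, sending `s ∈ S_d` to `s χ^d`. -/
def coaction : S →+* AddMonoidAlgebra S D :=
  (DirectSum.toSemiring (fun d => (AddMonoidAlgebra.singleAddHom d).comp (𝒜 d).subtype)
    (by simp [AddMonoidAlgebra.one_def])
    (by intro i j a b; simp [AddMonoidAlgebra.single_mul_single])).comp
    (DirectSum.decomposeRingEquiv 𝒜).toRingHom

theorem coaction_apply {d : D} {s : S} (hs : s ∈ 𝒜 d) :
    coaction 𝒜 s = AddMonoidAlgebra.single d s := by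
  lift s to 𝒜 d using hs
  simp [coaction, DirectSum.decomposeRingEquiv, DirectSum.toSemiring]

/-- The projection `pr : Spec S[D] = Spec S_0[D] ×_{Spec S_0} Spec S ⟶ Spec S`. -/
def prHom : (Spec (CommRingCat.of (AddMonoidAlgebra S D))).toLocallyRingedSpace ⟶
    (Spec (CommRingCat.of S)).toLocallyRingedSpace :=
  (Spec.map (CommRingCat.ofHom
    (AddMonoidAlgebra.singleZeroRingHom : S →+* AddMonoidAlgebra S D))).toLRSHom

/-- The action `Spec S[D] = Spec S_0[D] ×_{Spec S_0} Spec S ⟶ Spec S`. -/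
def actHom : (Spec (CommRingCat.of (AddMonoidAlgebra S D))).toLocallyRingedSpace ⟶
    (Spec (CommRingCat.of S)).toLocallyRingedSpace :=
  (Spec.map (CommRingCat.ofHom (coaction 𝒜))).toLRSHom

/-- The quotient `Q(S)` of `Spec S` by the action of `Spec S_0[D]`. It is formed in the category
of locally ringed spaces; Mathlib's instance `LocallyRingedSpace.preservesCoequalizer` says that
its underlying ringed space is the quotient in the category of ringed spaces. -/
def quot : LocallyRingedSpace.{u} := coequalizer (prHom (D := D) (S := S)) (actHom 𝒜)

/-- The quotient morphism `π : Spec S ⟶ Q(S)`. -/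
def quotMap : (Spec (CommRingCat.of S)).toLocallyRingedSpace ⟶ quot 𝒜 :=
  coequalizer.π _ _

/-- The morphism `Q(S) ⟶ Spec S_0` induced by the inclusion `S_0 ⊆ S`. -/
def quotToSpecZero : quot 𝒜 ⟶ (Spec (CommRingCat.of (𝒜 0))).toLocallyRingedSpace :=
  coequalizer.desc
    (Spec.map (CommRingCat.ofHom (algebraMap (𝒜 0) S))).toLRSHom
    (by
      have h : (AddMonoidAlgebra.singleZeroRingHom : S →+* AddMonoidAlgebra S D).comp
          (algebraMap (𝒜 0) S) =
          (coaction 𝒜).comp (algebraMap (𝒜 0) S) := by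
        ext x : 1
        exact (coaction_apply 𝒜 x.2).symm
      have h' := congrArg (fun φ => (Spec.map (CommRingCat.ofHom φ)).toLRSHom) h
      simp only [CommRingCat.ofHom_comp, Spec.map_comp] at h'
      exact h')

/-- The quotient morphism is, on underlying spaces, a coequalizer of topological spaces. -/
def quotTopIsColimit :
    IsColimit (Cofork.ofπ (f := LocallyRingedSpace.forgetToTop.map (prHom (D := D) (S := S)))
      (g := LocallyRingedSpace.forgetToTop.map (actHom 𝒜))
      (LocallyRingedSpace.forgetToTop.map (quotMap 𝒜))
      (by
        rw [← Functor.map_comp, ← Functor.map_comp]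
        exact congrArg _ (coequalizer.condition _ _))) :=
  isColimitCoforkMapOfIsColimit (SheafedSpace.forget _) _
    (isColimitCoforkMapOfIsColimit LocallyRingedSpace.forgetToSheafedSpace _
      (coequalizerIsCoequalizer (prHom (D := D) (S := S)) (actHom 𝒜)))

theorem homogeneousCore_invariant
    (P : (Spec (CommRingCat.of (AddMonoidAlgebra S D))).toLocallyRingedSpace) :
    homogeneousCore 𝒜 ((prHom (D := D) (S := S)).base P) =
      homogeneousCore 𝒜 ((actHom 𝒜).base P) := by
  have hP : P.asIdeal.IsPrime := P.isPrime
  have key : ∀ (d : D) (x : S), x ∈ 𝒜 d →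
      (x ∈ ((prHom (D := D) (S := S)).base P).asIdeal ↔ x ∈ ((actHom 𝒜).base P).asIdeal) := by
    intro d x hx
    have h1 : x ∈ ((prHom (D := D) (S := S)).base P).asIdeal ↔
        (AddMonoidAlgebra.single 0 x : AddMonoidAlgebra S D) ∈ P.asIdeal := Iff.rfl
    have h2 : x ∈ ((actHom 𝒜).base P).asIdeal ↔ coaction 𝒜 x ∈ P.asIdeal := Iff.rfl
    rw [h1, h2, coaction_apply 𝒜 hx]
    constructor
    · intro h
      have := P.asIdeal.mul_mem_right (AddMonoidAlgebra.single d (1 : S)) h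
      simpa [AddMonoidAlgebra.single_mul_single] using this
    · intro h
      have := P.asIdeal.mul_mem_right (AddMonoidAlgebra.single (-d) (1 : S)) h
      simpa [AddMonoidAlgebra.single_mul_single] using this
  have le : ∀ p q : DSpec 𝒜, (∀ (d : D) (x : S), x ∈ 𝒜 d → x ∈ p.asIdeal → x ∈ q.asIdeal) →
      p.asIdeal ≤ q.asIdeal := by
    intro p q h x hx
    classical
    rw [← DirectSum.sum_support_decompose 𝒜 x]
    exact sum_mem fun d _ => h d _ (SetLike.coe_mem _) (p.isHomogeneous d hx)
  ext1
  apply le_antisymm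
  · refine le _ _ fun d x hx h => ?_
    exact (mem_homogeneousCore 𝒜 ⟨d, hx⟩).2 ((key d x hx).1 ((mem_homogeneousCore 𝒜 ⟨d, hx⟩).1 h))
  · refine le _ _ fun d x hx h => ?_
    exact (mem_homogeneousCore 𝒜 ⟨d, hx⟩).2 ((key d x hx).2 ((mem_homogeneousCore 𝒜 ⟨d, hx⟩).1 h))

/-- The canonical continuous map `θ` from (the space underlying) `Q(S)` to the `D`-prime spectrum.
It sends the class of a prime ideal `P` to the `D`-prime ideal generated by the homogeneous
elements of `P`. -/
def theta : (quot 𝒜).toTopCat ⟶ TopCat.of (DSpec 𝒜) :=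
  Cofork.IsColimit.desc (quotTopIsColimit 𝒜)
    (TopCat.ofHom ⟨homogeneousCore 𝒜, continuous_homogeneousCore 𝒜⟩)
    (ConcreteCategory.hom_ext _ _ fun P => homogeneousCore_invariant 𝒜 P)

theorem theta_quotMap (P : PrimeSpectrum S) :
    theta 𝒜 ((quotMap 𝒜).base P) = homogeneousCore 𝒜 P :=
  ConcreteCategory.congr_hom (Cofork.IsColimit.π_desc' (quotTopIsColimit 𝒜)
    (TopCat.ofHom ⟨homogeneousCore 𝒜, continuous_homogeneousCore 𝒜⟩) _) P

theorem quotMap_surjective : Function.Surjective (quotMap 𝒜).base := by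
  have h := epi_of_isColimit_cofork (quotTopIsColimit 𝒜)
  exact (TopCat.epi_iff_surjective (LocallyRingedSpace.forgetToTop.map (quotMap 𝒜))).1 h

/-- The image in `Q(S)` of the open subset `{P | f ∉ P}` of `Spec S`. For relevant `f` this is the
open subset of `Q(S)` that is identified with `Spec S_(f)`. -/
def chartSet (f : S) : Set (quot 𝒜).toTopCat :=
  (quotMap 𝒜).base '' {P : PrimeSpectrum S | f ∉ P.asIdeal}

theorem chartSet_eq {f : S} (hf : SetLike.IsHomogeneousElem 𝒜 f) :
    chartSet 𝒜 f = theta 𝒜 ⁻¹' {p | f ∉ p.asIdeal} := by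
  ext z
  obtain ⟨P, rfl⟩ := quotMap_surjective 𝒜 z
  have h : ∀ P' : PrimeSpectrum S, f ∉ (theta 𝒜 ((quotMap 𝒜).base P')).asIdeal ↔ f ∉ P'.asIdeal :=
    fun P' => by rw [theta_quotMap]; exact not_congr (mem_homogeneousCore 𝒜 hf)
  constructor
  · rintro ⟨P', hP', h'⟩
    change f ∉ (theta 𝒜 _).asIdeal
    rw [← h']
    exact (h P').2 hP'
  · intro hz
    exact ⟨P, (h P).1 hz, rfl⟩

/-- The open subset of `Q(S)` underlying `Proj^D(S)`: the union of the subsets `Spec S_(f)` over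
all relevant `f`. -/
def projOpen : Opens (quot 𝒜).toTopCat where
  carrier := ⋃ f ∈ {f : S | IsRelevant 𝒜 f}, chartSet 𝒜 f
  is_open' := by
    refine isOpen_biUnion fun f hf => ?_
    rw [chartSet_eq 𝒜 hf.1]
    refine IsOpen.preimage (theta 𝒜).hom.continuous ?_
    have : {p : DSpec 𝒜 | f ∉ p.asIdeal} = (zeroLocus 𝒜 {f})ᶜ := by
      ext p
      simp [zeroLocus]
    rw [this]
    refine (isClosed_zeroLocus 𝒜 ?_).isOpen_compl
    rintro x rfl
    exact hf.1

/-- The multigraded spectrum `Proj^D(S)`, an open subspace of the quotient `Q(S)`. -/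
def multiProj : LocallyRingedSpace.{u} := (quot 𝒜).restrict (projOpen 𝒜).isOpenEmbedding

/-- The inclusion `Proj^D(S) ⟶ Q(S)`. -/
def multiProjIncl : multiProj 𝒜 ⟶ quot 𝒜 := (quot 𝒜).ofRestrict (projOpen 𝒜).isOpenEmbedding

/-- A morphism `j : Spec S_(f) ⟶ Proj^D(S)` is the canonical chart for `f` if it is an open
immersion and makes the square formed by `Spec S_f ⟶ Spec S ⟶ Q(S)` and
`Spec S_f ⟶ Spec S_(f) ⟶ Proj^D(S) ⟶ Q(S)` commute. -/
structure IsChart (f : S)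
    (j : (Spec (CommRingCat.of (HomogeneousLocalization.Away 𝒜 f))).toLocallyRingedSpace ⟶
      multiProj 𝒜) : Prop where
  isOpenImmersion : LocallyRingedSpace.IsOpenImmersion j
  fac : (Spec.map (CommRingCat.ofHom
        (algebraMap (HomogeneousLocalization.Away 𝒜 f) (Localization.Away f)))).toLRSHom ≫
      j ≫ multiProjIncl 𝒜 =
    (Spec.map (CommRingCat.ofHom (algebraMap S (Localization.Away f)))).toLRSHom ≫ quotMap 𝒜

/-- The `D`-prime spectrum as a ringed space. Its structure sheaf is the direct image of the
structure sheaf of `Q(S)` under `θ`. -/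
def dSpecRinged : SheafedSpace CommRingCat.{u} where
  carrier := TopCat.of (DSpec 𝒜)
  presheaf := (TopCat.Presheaf.pushforward _ (theta 𝒜)).obj (quot 𝒜).presheaf
  IsSheaf := TopCat.Sheaf.pushforward_sheaf_of_sheaf (theta 𝒜) (quot 𝒜).IsSheaf

/-- `θ` as a morphism of ringed spaces. -/
def thetaRinged : (quot 𝒜).toSheafedSpace ⟶ dSpecRinged 𝒜 :=
  InducedCategory.homMk { base := theta 𝒜, c := 𝟙 _ }

/-- `Proj_D(S)` as a ringed space, an open subspace of the `D`-prime spectrum. -/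
def projDRinged : SheafedSpace CommRingCat.{u} :=
  (dSpecRinged 𝒜).restrict (Opens.isOpenEmbedding (X := TopCat.of (DSpec 𝒜)) (projD 𝒜))

/-- The inclusion of `Proj_D(S)` into the `D`-prime spectrum. -/
def projDIncl : projDRinged 𝒜 ⟶ dSpecRinged 𝒜 :=
  (dSpecRinged 𝒜).ofRestrict (Opens.isOpenEmbedding (X := TopCat.of (DSpec 𝒜)) (projD 𝒜))

/-- The canonical homomorphism `S_(f) → S_(fg)` for homogeneous `g`. -/
def awayMapLeft (f : S) {g : S} (hg : SetLike.IsHomogeneousElem 𝒜 g) :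
    HomogeneousLocalization.Away 𝒜 f →+* HomogeneousLocalization.Away 𝒜 (f * g) :=
  HomogeneousLocalization.awayMap 𝒜 hg.choose_spec rfl

/-- The canonical homomorphism `S_(g) → S_(fg)` for homogeneous `f`. -/
def awayMapRight {f : S} (g : S) (hf : SetLike.IsHomogeneousElem 𝒜 f) :
    HomogeneousLocalization.Away 𝒜 g →+* HomogeneousLocalization.Away 𝒜 (f * g) :=
  HomogeneousLocalization.awayMap 𝒜 hf.choose_spec (mul_comm f g)

end MultigradedProj

end

noncomputable section

namespace MultigradedProj

open Opposite

section

variable {D S : Type u} [AddCommGroup D] [DecidableEq D] [CommRing S]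
variable (𝒜 : D → AddSubgroup S) [GradedRing 𝒜]

/-! ### Relevant elements -/

/-! Everything reduces to two facts: `θ` is bijective, and for relevant `f` the open piece of $Q(S)$
where $f$ does not vanish is $\mathrm{Spec}\,S_{(f)}$.

Surjectivity of `θ`: homogeneous elements outside a $D$-prime ideal $\mathfrak p$ are
nonzerodivisors modulo $\mathfrak p$, while elements of a minimal prime over $\mathfrak p$ are zero
divisors modulo $\mathfrak p$. So a minimal prime over $\mathfrak p$ has exactly the homogeneous
elements of $\mathfrak p$ (`DSpec.exists_prime_le`). Injectivity: if $P$ and $P'$ contain the same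
homogeneous elements, invert the homogeneous elements outside them. Both primes then lie over one
prime of the degree zero part, so there are $a,b:S\to\Omega$, with $\Omega$ algebraically closed,
having kernels $P,P'$ and agreeing on degree zero fractions. They differ by a character of a
subgroup of $D$, which extends to $D$ because $\Omega^\times$ is divisible; this gives a point of
$\mathrm{Spec}\,S[D]$ that projects to $P$ and acts to $P'$ (`quotMap_eq_of_homogeneousCore_eq`).

Charts (`exists_chartIso`): the coequalizer description makes sections of $Q(S)$ invariants, and the
invariants of $S_f$ are $S_{(f)}$. Relevance supplies units of $S_f$ in all degrees of $nD$ for some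
$n\neq 0$, so some power of any homogeneous element can be moved to degree zero. Hence a point of
$\mathrm{Spec}\,S_f$ has its homogeneous elements determined by its image in
$\mathrm{Spec}\,S_{(f)}$, generalizations lift, and $\mathrm{Spec}\,S_f\to\mathrm{Spec}\,S_{(f)}$ is
a topological quotient whose fibres are the fibres of $\pi$. Localization commutes with equalizers,
so the structure sheaves match too.

On a chart, `θ` carries the basic open set of $a/f^k$ to $\{\mathfrak p: fa\notin\mathfrak p\}$, so
it is open on $\mathrm{Proj}^D(S)$. As the sheaf on the $D$-prime spectrum is a direct image along a
bijection, the isomorphism follows. Part (a) is the chart for $f=1$, and the rest of (b) and (c)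
follows from $D$-primality and the charts being monomorphisms. -/

/-- For relevant `f` there are, up to a fixed multiple `n`, homogeneous divisors of powers of `f`
whose quotients have any prescribed degree. -/
theorem IsRelevant.exists_nsmul {f : S} (hf : IsRelevant 𝒜 f) :
    ∃ n : ℕ, n ≠ 0 ∧ ∀ d : D, ∃ (a b : S) (e : D),
      a ∈ 𝒜 (n • d + e) ∧ b ∈ 𝒜 e ∧ ∃ m, a * b ∣ f ^ m := by
  -- The differences $\deg a-\deg b$ with $ab$ dividing a power of $f$ already form a group, so they
  -- contain the group generated by the unit degrees.
  let T : AddSubgroup D :=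
    { carrier := {d | ∃ (a b : S) (e : D), a ∈ 𝒜 (d + e) ∧ b ∈ 𝒜 e ∧ ∃ m, a * b ∣ f ^ m}
      zero_mem' := ⟨1, 1, 0, by simpa using SetLike.one_mem_graded 𝒜, SetLike.one_mem_graded 𝒜,
        0, by simp⟩
      add_mem' := by
        rintro d d' ⟨a, b, e, ha, hb, m, h⟩ ⟨a', b', e', ha', hb', m', h'⟩
        refine ⟨a * a', b * b', e + e', ?_, SetLike.mul_mem_graded hb hb', m + m', ?_⟩
        · rw [add_add_add_comm]
          exact SetLike.mul_mem_graded ha ha'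
        · rw [mul_mul_mul_comm, pow_add]
          exact mul_dvd_mul h h'
      neg_mem' := by
        rintro d ⟨a, b, e, ha, hb, m, h⟩
        exact ⟨b, a, d + e, by simpa using hb, ha, m, by rwa [mul_comm]⟩ }
  have hT : supportGroup 𝒜 f ≤ T := by
    refine (AddSubgroup.closure_le _).2 ?_
    rintro d ⟨_, ⟨k, e, a, hk, ha, rfl⟩, hu⟩
    have h1 : IsUnit (algebraMap S (Localization.Away f) a) := by
      rw [Localization.mk_eq_mk', IsLocalization.mk'_eq_mul_mk'_one] at hu
      -- A unit fraction has a unit numerator, and an element of $S$ becomes a unit in $S_f$ exactly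
      -- when it divides a power of $f$.
      exact isUnit_of_mul_isUnit_left hu
    obtain ⟨m, hm⟩ := (IsLocalization.Away.algebraMap_isUnit_iff f).1 h1
    exact ⟨a, f ^ k, e, ha, hk, m + k, by rw [pow_add]; exact mul_dvd_mul hm dvd_rfl⟩
  have := hf.2
  -- The constant $n$ is the index of the support group.
  exact ⟨_, this.index_ne_zero, fun d => hT ((supportGroup 𝒜 f).nsmul_index_mem d)⟩

/-- Homogeneous multiples of relevant elements are relevant. -/
theorem IsRelevant.mul {f h : S} (hf : IsRelevant 𝒜 f) (hh : SetLike.IsHomogeneousElem 𝒜 h) :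
    IsRelevant 𝒜 (f * h) := by
  have hfin := hf.2
  refine ⟨hf.1.mul hh, AddSubgroup.finiteIndex_of_le (H := supportGroup 𝒜 f)
    (AddSubgroup.closure_mono ?_)⟩
  obtain ⟨c, hc⟩ := hh
  rintro d ⟨_, ⟨k, e, a, hk, ha, rfl⟩, hu⟩
  -- The image of the unit $a/f^k$ in $S_{fh}$ is $ah^k/(fh)^k$, of the same degree.
  have hpow : h ^ k ∈ 𝒜 (k • c) := SetLike.pow_mem_graded k hc
  refine ⟨Localization.mk (a * h ^ k) (⟨(f * h) ^ k, k, rfl⟩ : Submonoid.powers (f * h)),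
    ⟨k, e + k • c, a * h ^ k, ?_, ?_, rfl⟩, ?_⟩
  · rw [mul_pow]
    exact SetLike.mul_mem_graded hk hpow
  · rw [← add_assoc]
    exact SetLike.mul_mem_graded ha hpow
  · have h1 : IsUnit (algebraMap S (Localization.Away f) a) := by
      rw [Localization.mk_eq_mk', IsLocalization.mk'_eq_mul_mk'_one] at hu
      exact isUnit_of_mul_isUnit_left hu
    obtain ⟨m, hm⟩ := (IsLocalization.Away.algebraMap_isUnit_iff f).1 h1
    have h2 : IsUnit (algebraMap S (Localization.Away (f * h)) (a * h ^ k)) := by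
      refine (IsLocalization.Away.algebraMap_isUnit_iff (f * h)).2 ⟨m + k, ?_⟩
      rw [pow_add]
      refine mul_dvd_mul (hm.trans ?_) ?_
      · exact pow_dvd_pow_of_dvd (dvd_mul_right f h) m
      · exact pow_dvd_pow_of_dvd (dvd_mul_left h f) k
    rw [Localization.mk_eq_mk', IsLocalization.mk'_eq_mul_mk'_one]
    refine h2.mul ?_
    refine IsUnit.of_mul_eq_one (algebraMap S (Localization.Away (f * h)) ((f * h) ^ k)) ?_
    have := IsLocalization.mk'_spec (Localization.Away (f * h)) 1
      (⟨(f * h) ^ k, k, rfl⟩ : Submonoid.powers (f * h))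
    simpa using this

/-! ### `D`-prime ideals -/

variable {𝒜}

theorem DSpec.notMem_of_dvd_pow (p : DSpec 𝒜) {f : S} (hf : SetLike.IsHomogeneousElem 𝒜 f)
    (hfp : f ∉ p.asIdeal) {a : S} {m : ℕ} (ha : a ∣ f ^ m) : a ∉ p.asIdeal := by
  intro h
  have hm : f ^ m ∈ p.asIdeal := p.asIdeal.mem_of_dvd ha h
  clear ha h
  induction m with
  | zero => exact p.ne_top ((Ideal.eq_top_iff_one _).2 (by simpa using hm))
  | succ m ih =>
    rw [pow_succ] at hm
    obtain ⟨e, he⟩ := hf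
    exact (p.mem_or_mem _ _ ⟨_, SetLike.pow_mem_graded m he⟩ ⟨e, he⟩ hm).elim ih hfp

theorem DSpec.le_of_homogeneous {p : DSpec 𝒜} {I : Ideal S}
    (h : ∀ (d : D) (x : S), x ∈ 𝒜 d → x ∈ p.asIdeal → x ∈ I) : p.asIdeal ≤ I := by
  intro x hx
  classical
  rw [← DirectSum.sum_support_decompose 𝒜 x]
  exact sum_mem fun d _ => h d _ (SetLike.coe_mem _) (p.isHomogeneous d hx)

/-- A homogeneous element outside a `D`-prime ideal is a nonzerodivisor modulo that ideal. -/
theorem DSpec.mem_of_mul_mem (p : DSpec 𝒜) {h : S} (hh : SetLike.IsHomogeneousElem 𝒜 h)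
    (hp : h ∉ p.asIdeal) {x : S} (hx : h * x ∈ p.asIdeal) : x ∈ p.asIdeal := by
  classical
  obtain ⟨e, he⟩ := hh
  rw [← DirectSum.sum_support_decompose 𝒜 x]
  refine sum_mem fun d _ => ?_
  have h1 : (DirectSum.decompose 𝒜 (h * x) (e + d) : S) ∈ p.asIdeal := p.isHomogeneous _ hx
  rw [DirectSum.coe_decompose_mul_add_of_left_mem 𝒜 he] at h1
  exact (p.mem_or_mem _ _ ⟨e, he⟩ ⟨d, SetLike.coe_mem _⟩ h1).resolve_left hp

/-- Below a prime ideal that contains a `D`-prime ideal there is a prime ideal whose homogeneous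
elements are exactly those of the `D`-prime ideal. -/
theorem DSpec.exists_prime_le (p : DSpec 𝒜) (P : PrimeSpectrum S) (h : p.asIdeal ≤ P.asIdeal) :
    ∃ P₀ : PrimeSpectrum S, P₀ ≤ P ∧ homogeneousCore 𝒜 P₀ = p := by
  have := P.isPrime
  -- A prime minimal over $\mathfrak p$ consists of zero divisors modulo $\mathfrak p$, which
  -- homogeneous elements outside $\mathfrak p$ are not.
  obtain ⟨P₀, hP₀, hle⟩ := Ideal.exists_minimalPrimes_le h
  have hprime : P₀.IsPrime := hP₀.1.1
  refine ⟨⟨P₀, hprime⟩, hle, DSpec.ext (le_antisymm ?_ ?_)⟩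
  · refine DSpec.le_of_homogeneous fun d x hx h => ?_
    by_contra hxp
    obtain ⟨y, hy, hxy⟩ := Ideal.exists_mul_mem_of_mem_minimalPrimes hP₀
      ((mem_homogeneousCore 𝒜 ⟨d, hx⟩).1 h)
    exact hy (p.mem_of_mul_mem ⟨d, hx⟩ hxp hxy)
  · exact DSpec.le_of_homogeneous fun d x hx h =>
      (mem_homogeneousCore 𝒜 ⟨d, hx⟩).2 (hP₀.1.2 h)

theorem exists_homogeneousCore_eq (p : DSpec 𝒜) :
    ∃ P : PrimeSpectrum S, homogeneousCore 𝒜 P = p := by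
  obtain ⟨M, hM, hle⟩ := Ideal.exists_le_maximal _ p.ne_top
  obtain ⟨P, -, hP⟩ := p.exists_prime_le ⟨M, hM.isPrime⟩ hle
  exact ⟨P, hP⟩

theorem homogeneousCore_eq_iff {P P' : PrimeSpectrum S} :
    homogeneousCore 𝒜 P = homogeneousCore 𝒜 P' ↔
      ∀ x, SetLike.IsHomogeneousElem 𝒜 x → (x ∈ P.asIdeal ↔ x ∈ P'.asIdeal) := by
  constructor
  · intro h x hx
    rw [← mem_homogeneousCore 𝒜 hx, h, mem_homogeneousCore 𝒜 hx]
  · intro h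
    refine DSpec.ext (le_antisymm ?_ ?_)
    · exact DSpec.le_of_homogeneous fun d x hx hP => (mem_homogeneousCore 𝒜 ⟨d, hx⟩).2
        ((h x ⟨d, hx⟩).1 ((mem_homogeneousCore 𝒜 ⟨d, hx⟩).1 hP))
    · exact DSpec.le_of_homogeneous fun d x hx hP => (mem_homogeneousCore 𝒜 ⟨d, hx⟩).2
        ((h x ⟨d, hx⟩).2 ((mem_homogeneousCore 𝒜 ⟨d, hx⟩).1 hP))

/-! ### The coaction on `S_f` -/

variable (𝒜)

theorem isUnit_coaction_away {f : S} (hf : SetLike.IsHomogeneousElem 𝒜 f) :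
    IsUnit (((AddMonoidAlgebra.mapRingHom D (algebraMap S (Localization.Away f))).comp
      (coaction 𝒜)) f) := by
  obtain ⟨e, he⟩ := hf
  have hu := IsLocalization.Away.algebraMap_isUnit (S := Localization.Away f) f
  obtain ⟨u, hu⟩ := hu
  rw [RingHom.comp_apply, coaction_apply 𝒜 he, AddMonoidAlgebra.mapRingHom_single]
  refine IsUnit.of_mul_eq_one (AddMonoidAlgebra.single (-e) ((u⁻¹ : (Localization.Away f)ˣ) :
    Localization.Away f)) ?_
  rw [AddMonoidAlgebra.single_mul_single, ← hu]
  simp [AddMonoidAlgebra.one_def]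

/-- The coaction `S_f → S_f[D]`. -/
def coactionAway {f : S} (hf : SetLike.IsHomogeneousElem 𝒜 f) :
    Localization.Away f →+* AddMonoidAlgebra (Localization.Away f) D :=
  Localization.awayLift _ f (isUnit_coaction_away 𝒜 hf)

theorem coactionAway_algebraMap {f : S} (hf : SetLike.IsHomogeneousElem 𝒜 f) (x : S) :
    coactionAway 𝒜 hf (algebraMap S _ x) =
      AddMonoidAlgebra.mapRingHom D (algebraMap S (Localization.Away f)) (coaction 𝒜 x) :=
  IsLocalization.lift_eq _ _

theorem coactionAway_mk {f : S} (hf : SetLike.IsHomogeneousElem 𝒜 f) {e d : D}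
    (he : f ∈ 𝒜 e) (k : ℕ) {x : S} (hx : x ∈ 𝒜 d) :
    coactionAway 𝒜 hf
        (Localization.mk x (⟨f ^ k, k, rfl⟩ : Submonoid.powers f)) =
      AddMonoidAlgebra.single (d - k • e)
        (Localization.mk x (⟨f ^ k, k, rfl⟩ : Submonoid.powers f)) := by
  have hu : IsUnit (coactionAway 𝒜 hf (algebraMap S _ (f ^ k))) := by
    rw [map_pow, map_pow]
    exact ((IsLocalization.Away.algebraMap_isUnit f).map _).pow k
  have hspec : Localization.mk x (⟨f ^ k, k, rfl⟩ : Submonoid.powers f) *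
      algebraMap S (Localization.Away f) (f ^ k) = algebraMap S (Localization.Away f) x := by
    rw [Localization.mk_eq_mk']
    exact IsLocalization.mk'_spec _ x (⟨f ^ k, k, rfl⟩ : Submonoid.powers f)
  refine hu.mul_left_injective ?_
  change _ * _ = _ * _
  rw [← map_mul, hspec, coactionAway_algebraMap, coactionAway_algebraMap, coaction_apply 𝒜 hx,
    coaction_apply 𝒜 (SetLike.pow_mem_graded k he), AddMonoidAlgebra.mapRingHom_single,
    AddMonoidAlgebra.mapRingHom_single, AddMonoidAlgebra.single_mul_single, hspec,
    sub_add_cancel]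

theorem coactionAway_algebraMap_degreeZero {f : S} (hf : SetLike.IsHomogeneousElem 𝒜 f)
    (x : HomogeneousLocalization.Away 𝒜 f) :
    coactionAway 𝒜 hf (algebraMap _ (Localization.Away f) x) =
      AddMonoidAlgebra.single 0 (algebraMap _ (Localization.Away f) x) := by
  obtain ⟨e, he⟩ := id hf
  obtain ⟨k, a, ha, rfl⟩ := HomogeneousLocalization.Away.mk_surjective 𝒜 he x
  have := coactionAway_mk 𝒜 hf he k ha
  rwa [sub_self] at this

/-- The coefficient at $\chi^0$ of the coaction is the projection of $S_f$ onto its degree zero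
part; it serves as a Reynolds operator. -/
theorem coeff_zero_coactionAway_mem {f : S} (hf : SetLike.IsHomogeneousElem 𝒜 f)
    (y : Localization.Away f) :
    (coactionAway 𝒜 hf y).coeff 0 ∈
      (algebraMap (HomogeneousLocalization.Away 𝒜 f) (Localization.Away f)).range := by
  obtain ⟨e, he⟩ := id hf
  induction y using Localization.induction_on with
  | H y =>
    obtain ⟨x, _, k, rfl⟩ := y
    induction x using DirectSum.Decomposition.inductionOn 𝒜 with
    | zero => simp [Localization.mk_zero]
    | @homogeneous d x =>
      rw [coactionAway_mk 𝒜 hf he k x.2, AddMonoidAlgebra.coeff_single, Finsupp.single_apply]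
      split_ifs with h
      · exact ⟨HomogeneousLocalization.Away.mk 𝒜 he k x (by rw [← sub_eq_zero.1 h]; exact x.2), rfl⟩
      · exact zero_mem _
    | add x y hx hy =>
      rw [← Localization.add_mk_self, map_add]
      exact add_mem hx hy

/-- `S_(f)` consists of the invariants of `S_f`. -/
theorem mem_range_of_coactionAway_eq {f : S} (hf : SetLike.IsHomogeneousElem 𝒜 f)
    {y : Localization.Away f} (hy : coactionAway 𝒜 hf y = AddMonoidAlgebra.single 0 y) :
    y ∈ (algebraMap (HomogeneousLocalization.Away 𝒜 f) (Localization.Away f)).range := by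
  have := coeff_zero_coactionAway_mem 𝒜 hf y
  rwa [hy, AddMonoidAlgebra.coeff_single, Finsupp.single_eq_same] at this

theorem algebraMap_degreeZero_injective (f : S) : Function.Injective
    (algebraMap (HomogeneousLocalization.Away 𝒜 f) (Localization.Away f)) :=
  HomogeneousLocalization.val_injective _

/-- The projection onto degree zero is an $S_{(f)}$-linear retraction of $S_f$, so extending an
ideal to $S_f$ adds nothing in degree zero. -/
theorem comap_map_degreeZero {f : S} (hf : SetLike.IsHomogeneousElem 𝒜 f)
    (q : Ideal (HomogeneousLocalization.Away 𝒜 f)) :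
    (q.map (algebraMap _ (Localization.Away f))).comap
      (algebraMap _ (Localization.Away f)) = q := by
  refine le_antisymm ?_ Ideal.le_comap_map
  -- The factor `b` is carried along so that the induction over the span survives multiplication by
  -- arbitrary elements of $S_f$.
  have key : ∀ y ∈ q.map (algebraMap _ (Localization.Away f)), ∀ b : Localization.Away f,
      ∃ x ∈ q, algebraMap _ (Localization.Away f) x = (coactionAway 𝒜 hf (b * y)).coeff 0 := by
    intro y hy
    induction hy using Submodule.span_induction with
    | mem y hy =>
      obtain ⟨x, hx, rfl⟩ := hy
      intro b
      obtain ⟨c, hc⟩ := coeff_zero_coactionAway_mem 𝒜 hf b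
      refine ⟨c * x, q.mul_mem_left c hx, ?_⟩
      rw [map_mul, map_mul, coactionAway_algebraMap_degreeZero,
        AddMonoidAlgebra.coeff_mul_single_zero, hc]
    | zero => exact fun b => ⟨0, zero_mem _, by simp⟩
    | add y z _ _ hy hz =>
      intro b
      obtain ⟨a, ha, hay⟩ := hy b
      obtain ⟨c, hc, hcz⟩ := hz b
      refine ⟨a + c, add_mem ha hc, ?_⟩
      rw [map_add, hay, hcz, mul_add, map_add]
      rfl
    | smul c y _ hy =>
      intro b
      rw [smul_eq_mul, ← mul_assoc]
      exact hy (b * c)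
  intro x hx
  obtain ⟨x', hx', h⟩ := key _ hx 1
  rw [one_mul, coactionAway_algebraMap_degreeZero, AddMonoidAlgebra.coeff_single,
    Finsupp.single_eq_same] at h
  exact algebraMap_degreeZero_injective 𝒜 f h ▸ hx'

end

section

variable {D S : Type u} [AddCommGroup D] [DecidableEq D] [CommRing S]
variable (𝒜 : D → AddSubgroup S) [GradedRing 𝒜]

/-! ### The map `Spec S_f ⟶ Spec S_(f)` -/

/-- The form of relevance used below: for $x$ of degree $d$ the fraction $x^nv/f^m$ has degree zero,
and $v$ is a unit in $S_f$. -/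
theorem IsRelevant.exists_mem_sub {f : S} (hf : IsRelevant 𝒜 f) {e : D} (he : f ∈ 𝒜 e) :
    ∃ n : ℕ, n ≠ 0 ∧ ∀ d : D, ∃ (v : S) (m : ℕ), v ∈ 𝒜 (m • e - n • d) ∧ ∃ M, v ∣ f ^ M := by
  obtain ⟨n, hn, h⟩ := hf.exists_nsmul
  refine ⟨n, hn, fun d => ?_⟩
  obtain ⟨a, b, c, ha, hb, m, w, hw⟩ := h d
  -- The cofactor $w$ in $abw=f^m$ may be replaced by its homogeneous component of the complementary
  -- degree.
  have hw' : a * (b * DirectSum.decompose 𝒜 w (m • e - n • d - c - c) : S) = f ^ m := by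
    have h1 := DirectSum.coe_decompose_mul_add_of_left_mem 𝒜
      (b := w) (j := m • e - n • d - c - c) (SetLike.mul_mem_graded ha hb)
    rw [← hw, show n • d + c + c + (m • e - n • d - c - c) = m • e by abel,
      DirectSum.decompose_of_mem_same 𝒜 (SetLike.pow_mem_graded m he)] at h1
    rw [h1, mul_assoc]
  -- With the homogeneous cofactor $w'$, the element $v=b\cdot bw'$ equals $bf^m/a$ in $S_f$; the
  -- factors $b$ and $bw'$ each divide $f^m$.
  refine ⟨b * (b * DirectSum.decompose 𝒜 w (m • e - n • d - c - c) : S), m, ?_, m + m, ?_⟩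
  · have := SetLike.mul_mem_graded hb (SetLike.mul_mem_graded hb
      (SetLike.coe_mem (DirectSum.decompose 𝒜 w (m • e - n • d - c - c))))
    rwa [show c + (c + (m • e - n • d - c - c)) = m • e - n • d by abel] at this
  · rw [pow_add]
    exact mul_dvd_mul ⟨a * w, by rw [hw]; ring⟩ ⟨_, by rw [← hw']; ring⟩

theorem mk_mem_comap_iff {f : S} {e : D} (he : f ∈ 𝒜 e) (P : PrimeSpectrum (Localization.Away f))
    (k : ℕ) (a : S) (ha : a ∈ 𝒜 (k • e)) :
    HomogeneousLocalization.Away.mk 𝒜 he k a ha ∈ (PrimeSpectrum.comap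
        (algebraMap (HomogeneousLocalization.Away 𝒜 f) (Localization.Away f)) P).asIdeal ↔
      a ∈ (PrimeSpectrum.comap (algebraMap S (Localization.Away f)) P).asIdeal := by
  change Localization.mk a (⟨f ^ k, k, rfl⟩ : Submonoid.powers f) ∈ P.asIdeal ↔
    algebraMap S (Localization.Away f) a ∈ P.asIdeal
  rw [Localization.mk_eq_mk', IsLocalization.mk'_mem_iff]

theorem notMem_comap (f : S) (P : PrimeSpectrum (Localization.Away f)) :
    f ∉ (PrimeSpectrum.comap (algebraMap S (Localization.Away f)) P).asIdeal := fun h =>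
  P.isPrime.ne_top (Ideal.eq_top_of_isUnit_mem _ h (IsLocalization.Away.algebraMap_isUnit f))

theorem exists_comap_away {f : S} (P : PrimeSpectrum S) (hP : f ∉ P.asIdeal) :
    ∃ P' : PrimeSpectrum (Localization.Away f),
      PrimeSpectrum.comap (algebraMap S (Localization.Away f)) P' = P := by
  have h : P ∈ Set.range (PrimeSpectrum.comap (algebraMap S (Localization.Away f))) := by
    rw [PrimeSpectrum.localization_away_comap_range (Localization.Away f) f]
    exact hP
  exact h

variable {𝒜}

/-- Two points of `Spec S_f` whose homogeneous elements agree have the same image in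
`Spec S_(f)`. -/
theorem comap_degreeZero_le {f : S} (hf : SetLike.IsHomogeneousElem 𝒜 f)
    {P P' : PrimeSpectrum (Localization.Away f)}
    (h : (homogeneousCore 𝒜 (PrimeSpectrum.comap (algebraMap S (Localization.Away f)) P)).asIdeal ≤
      (homogeneousCore 𝒜 (PrimeSpectrum.comap (algebraMap S (Localization.Away f)) P')).asIdeal) :
    PrimeSpectrum.comap (algebraMap (HomogeneousLocalization.Away 𝒜 f) (Localization.Away f)) P ≤
      PrimeSpectrum.comap (algebraMap (HomogeneousLocalization.Away 𝒜 f) (Localization.Away f))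
        P' := by
  obtain ⟨e, he⟩ := hf
  intro x hx
  obtain ⟨k, a, ha, rfl⟩ := HomogeneousLocalization.Away.mk_surjective 𝒜 he x
  have hx := (mk_mem_comap_iff 𝒜 he P k a ha).1 hx
  exact (mk_mem_comap_iff 𝒜 he P' k a ha).2 ((mem_homogeneousCore 𝒜 ⟨_, ha⟩).1
    (h ((mem_homogeneousCore 𝒜 ⟨_, ha⟩).2 hx)))

/-- For relevant `f`, the image of a point in `Spec S_(f)` determines its homogeneous elements. -/
theorem IsRelevant.homogeneousCore_le {f : S} (hf : IsRelevant 𝒜 f)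
    {P P' : PrimeSpectrum (Localization.Away f)}
    (h : PrimeSpectrum.comap (algebraMap (HomogeneousLocalization.Away 𝒜 f)
      (Localization.Away f)) P ≤ PrimeSpectrum.comap
        (algebraMap (HomogeneousLocalization.Away 𝒜 f) (Localization.Away f)) P') :
    (homogeneousCore 𝒜 (PrimeSpectrum.comap (algebraMap S (Localization.Away f)) P)).asIdeal ≤
      (homogeneousCore 𝒜 (PrimeSpectrum.comap (algebraMap S (Localization.Away f)) P')).asIdeal := by
  obtain ⟨e, he⟩ := hf.1
  obtain ⟨n, hn, hv⟩ := hf.exists_mem_sub 𝒜 he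
  refine DSpec.le_of_homogeneous fun d x hx hxP => ?_
  rw [mem_homogeneousCore 𝒜 ⟨d, hx⟩] at hxP ⊢
  obtain ⟨v, m, hv, M, hM⟩ := hv d
  -- Multiplying $x^n$ by $v$ reaches a degree where $S_{(f)}$ sees it; in the target prime $v$ can
  -- be cancelled because it divides a power of $f$.
  have hmem : x ^ n * v ∈ 𝒜 (m • e) := by
    have := SetLike.mul_mem_graded (SetLike.pow_mem_graded n hx) hv
    rwa [add_sub_cancel] at this
  have h1 := (mk_mem_comap_iff 𝒜 he P' m _ hmem).1 (h ((mk_mem_comap_iff 𝒜 he P m _ hmem).2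
    (Ideal.mul_mem_right _ _ (Ideal.pow_mem_of_mem _ hxP n (Nat.pos_of_ne_zero hn)))))
  refine (PrimeSpectrum.isPrime _).mem_of_pow_mem n
    (((PrimeSpectrum.isPrime _).mem_or_mem h1).resolve_right fun hvP => ?_)
  exact notMem_comap f P' ((PrimeSpectrum.isPrime _).mem_of_pow_mem M (Ideal.mem_of_dvd _ hM hvP))

theorem comap_degreeZero_surjective {f : S} (hf : SetLike.IsHomogeneousElem 𝒜 f) :
    Function.Surjective (PrimeSpectrum.comap
      (algebraMap (HomogeneousLocalization.Away 𝒜 f) (Localization.Away f))) := fun q =>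
  (PrimeSpectrum.mem_range_comap_iff _).2 (comap_map_degreeZero 𝒜 hf q.asIdeal)

/-- A surjective map of spectra along which generalizations lift is a quotient map. To lift $q\le$
the image of $P$, choose any $P_1$ over $q$: by relevance its homogeneous elements lie in $P$, and a
minimal prime below $P$ over the ideal they generate has the same homogeneous elements as $P_1$,
hence the same image $q$. -/
theorem IsRelevant.isQuotientMap_comap {f : S} (hf : IsRelevant 𝒜 f) :
    Topology.IsQuotientMap (PrimeSpectrum.comap
      (algebraMap (HomogeneousLocalization.Away 𝒜 f) (Localization.Away f))) := by
  refine PrimeSpectrum.isQuotientMap_of_generalizingMap (comap_degreeZero_surjective hf.1) ?_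
  intro P q hq
  rw [← PrimeSpectrum.le_iff_specializes] at hq
  obtain ⟨P₁, rfl⟩ := comap_degreeZero_surjective hf.1 q
  obtain ⟨P₀, hle, hP₀⟩ := DSpec.exists_prime_le _
    (PrimeSpectrum.comap (algebraMap S (Localization.Away f)) P)
    ((hf.homogeneousCore_le hq).trans (Ideal.toIdeal_homogeneousCore_le 𝒜 _))
  obtain ⟨P₀, rfl⟩ := exists_comap_away P₀ fun h => notMem_comap f P (hle h)
  refine ⟨P₀, (PrimeSpectrum.le_iff_specializes _ _).1 ?_, le_antisymm ?_ ?_⟩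
  · exact (IsLocalization.orderEmbedding (Submonoid.powers f) _).le_iff_le.1 hle
  · exact comap_degreeZero_le hf.1 (by rw [hP₀])
  · exact comap_degreeZero_le hf.1 (by rw [hP₀])

end

section

variable {D S : Type u} [AddCommGroup D] [DecidableEq D] [CommRing S]
variable (𝒜 : D → AddSubgroup S) [GradedRing 𝒜]

/-! ### Points with the same homogeneous elements are identified in `Q(S)` -/

/-- Two points of affine schemes over the same point of the base have a common field-valued
point, with algebraically closed field. -/
theorem exists_isAlgClosed_ringHom {R A B : Type u} [CommRing R] [CommRing A] [CommRing B]
    [Algebra R A] [Algebra R B] (P : PrimeSpectrum A) (P' : PrimeSpectrum B)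
    (h : PrimeSpectrum.comap (algebraMap R A) P = PrimeSpectrum.comap (algebraMap R B) P') :
    ∃ (Ω : Type u) (_ : Field Ω) (_ : IsAlgClosed Ω) (a : A →+* Ω) (b : B →+* Ω),
      a.comp (algebraMap R A) = b.comp (algebraMap R B) ∧
      RingHom.ker a = P.asIdeal ∧ RingHom.ker b = P'.asIdeal := by
  let fA : Spec (.of A) ⟶ Spec (.of R) := Spec.map (CommRingCat.ofHom (algebraMap R A))
  let fB : Spec (.of B) ⟶ Spec (.of R) := Spec.map (CommRingCat.ofHom (algebraMap R B))
  obtain ⟨z, hz, hz'⟩ := Scheme.Pullback.exists_preimage_pullback (f := fA) (g := fB) P P' h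
  let K := (pullback fA fB).residueField z
  let t : Spec K ⟶ pullback fA fB := (pullback fA fB).fromSpecResidueField z
  let Ω := AlgebraicClosure K
  have ht : ∀ x, t x = z := fun x => (pullback fA fB).fromSpecResidueField_apply z x
  let s : Spec (.of Ω) ⟶ pullback fA fB := Spec.map (CommRingCat.ofHom (algebraMap K Ω)) ≫ t
  have hs : ∀ x, s x = z := fun x => ht _
  obtain ⟨a, ha⟩ := Spec.map_surjective (s ≫ pullback.fst fA fB)
  obtain ⟨b, hb⟩ := Spec.map_surjective (s ≫ pullback.snd fA fB)
  refine ⟨Ω, inferInstance, inferInstance, a.hom, b.hom, ?_, ?_, ?_⟩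
  · have : CommRingCat.ofHom (algebraMap R A) ≫ a = CommRingCat.ofHom (algebraMap R B) ≫ b := by
      apply Spec.map_injective
      rw [Spec.map_comp, Spec.map_comp, ha, hb, Category.assoc, Category.assoc]
      exact congrArg (s ≫ ·) pullback.condition
    exact congrArg CommRingCat.Hom.hom this
  · have h1 : Spec.map a (⊥ : PrimeSpectrum Ω) = P := by
      rw [ha]
      exact (congrArg (pullback.fst fA fB) (hs (⊥ : PrimeSpectrum Ω))).trans hz
    have h2 := congrArg PrimeSpectrum.asIdeal h1
    exact h2
  · have h1 : Spec.map b (⊥ : PrimeSpectrum Ω) = P' := by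
      rw [hb]
      exact (congrArg (pullback.snd fA fB) (hs (⊥ : PrimeSpectrum Ω))).trans hz'
    have h2 := congrArg PrimeSpectrum.asIdeal h1
    exact h2

variable {𝒜}

/-- The cross-multiplied identity says that $a$ and $b$ agree on degree zero fractions $r/s$. They
come from a common geometric point of two primes lying over the same prime of the degree zero
localization. -/
theorem exists_ringHom_of_homogeneousCore_eq {P P' : PrimeSpectrum S}
    (h : homogeneousCore 𝒜 P = homogeneousCore 𝒜 P') :
    ∃ (Ω : Type u) (_ : Field Ω) (_ : IsAlgClosed Ω) (a b : S →+* Ω),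
      RingHom.ker a = P.asIdeal ∧ RingHom.ker b = P'.asIdeal ∧
      ∀ (d : D), ∀ r ∈ 𝒜 d, ∀ s ∈ 𝒜 d, a r * b s = b r * a s := by
  have hP := P.isPrime
  have hP' := P'.isPrime
  rw [homogeneousCore_eq_iff] at h
  let M : Submonoid S := SetLike.homogeneousSubmonoid 𝒜 ⊓ P.asIdeal.primeCompl
  have hM : M ≤ P.asIdeal.primeCompl := inf_le_right
  have hM' : M ≤ P'.asIdeal.primeCompl := fun x hx => fun h' => hx.2 ((h x hx.1).2 h')
  have hex : ∀ Q : PrimeSpectrum S, M ≤ Q.asIdeal.primeCompl →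
      ∃ Q' : PrimeSpectrum (Localization M),
      PrimeSpectrum.comap (algebraMap S (Localization M)) Q' = Q := by
    intro Q hQ
    have h : Q ∈ Set.range (PrimeSpectrum.comap (algebraMap S (Localization M))) := by
      rw [PrimeSpectrum.localization_comap_range (Localization M) M]
      exact Set.disjoint_left.2 fun x hx => hQ hx
    exact h
  obtain ⟨L, hL⟩ := hex P hM
  obtain ⟨L', hL'⟩ := hex P' hM'
  have hmem : ∀ x, x ∈ P.asIdeal ↔ algebraMap S (Localization M) x ∈ L.asIdeal := fun x => by
    rw [← hL]; rfl
  have hmem' : ∀ x, x ∈ P'.asIdeal ↔ algebraMap S (Localization M) x ∈ L'.asIdeal := fun x => by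
    rw [← hL']; rfl
  -- A fraction lies in either prime exactly when its numerator does, and numerators are
  -- homogeneous, so both primes have the same contraction.
  obtain ⟨Ω, i, j, a, b, hab, ha, hb⟩ := exists_isAlgClosed_ringHom
    (R := HomogeneousLocalization 𝒜 M) L L' (by
      ext x
      obtain ⟨x, rfl⟩ := HomogeneousLocalization.mk_surjective x
      change Localization.mk _ _ ∈ L.asIdeal ↔ Localization.mk _ _ ∈ L'.asIdeal
      rw [Localization.mk_eq_mk', IsLocalization.mk'_mem_iff, IsLocalization.mk'_mem_iff,
        ← hmem, ← hmem']
      exact h _ ⟨_, x.num.2⟩)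
  have hka : RingHom.ker (a.comp (algebraMap S (Localization M))) = P.asIdeal := by
    ext x
    rw [hmem, ← ha]; rfl
  have hkb : RingHom.ker (b.comp (algebraMap S (Localization M))) = P'.asIdeal := by
    ext x
    rw [hmem', ← hb]; rfl
  refine ⟨Ω, i, j, a.comp (algebraMap S _), b.comp (algebraMap S _), hka, hkb, ?_⟩
  intro d r hr s hs
  by_cases hsP : s ∈ P.asIdeal
  · have hsP' := (h s ⟨d, hs⟩).1 hsP
    rw [← hka, RingHom.mem_ker] at hsP
    rw [← hkb, RingHom.mem_ker] at hsP'
    rw [hsP, hsP', mul_zero, mul_zero]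
  · have hsM : s ∈ M := ⟨⟨d, hs⟩, hsP⟩
    let t : HomogeneousLocalization 𝒜 M := HomogeneousLocalization.mk ⟨d, ⟨r, hr⟩, ⟨s, hs⟩, hsM⟩
    have ht : algebraMap _ (Localization M) t * algebraMap S _ s = algebraMap S _ r := by
      change Localization.mk r ⟨s, hsM⟩ * algebraMap S (Localization M) s = _
      rw [Localization.mk_eq_mk']
      exact IsLocalization.mk'_spec _ r (⟨s, hsM⟩ : M)
    have hab' := congrArg (fun φ => φ t) hab
    simp only [RingHom.comp_apply] at hab' ⊢
    rw [← ht, map_mul, map_mul, hab']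
    ring

theorem divisible_additive_units (Ω : Type*) [Field Ω] [IsAlgClosed Ω] :
    Nonempty (DivisibleBy (Additive Ωˣ) ℤ) := by
  have : DivisibleBy (Additive Ωˣ) ℕ := divisibleByOfSMulRightSurj _ _ fun {n} hn u => by
    obtain ⟨z, hz⟩ := IsAlgClosed.exists_pow_nat_eq (u.toMul : Ω) (Nat.pos_of_ne_zero hn)
    have hz0 : z ≠ 0 := by
      rintro rfl
      rw [zero_pow hn] at hz
      exact u.toMul.ne_zero hz.symm
    exact ⟨Additive.ofMul (Units.mk0 z hz0), congrArg Additive.ofMul (Units.ext hz)⟩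
  exact ⟨AddGroup.divisibleByIntOfDivisibleByNat _⟩

/-- Two ring homomorphisms to an algebraically closed field that agree on homogeneous fractions of
degree zero differ by a character of the grading group. -/
theorem exists_character {Ω : Type*} [Field Ω] [IsAlgClosed Ω] {a b : S →+* Ω}
    (hker : ∀ (d : D), ∀ x ∈ 𝒜 d, a x = 0 ↔ b x = 0)
    (hab : ∀ (d : D), ∀ r ∈ 𝒜 d, ∀ s ∈ 𝒜 d, a r * b s = b r * a s) :
    ∃ χ : D →+ Additive Ωˣ, ∀ (d : D), ∀ x ∈ 𝒜 d, b x = a x * ((χ d).toMul : Ω) := by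
  -- `R d u`: the quotient $b/a$ takes the value $u$ on some homogeneous fraction $r/s$ of degree
  -- $d$. The hypothesis `hab` makes this value depend on $d$ alone.
  let R (d : D) (u : Ωˣ) : Prop := ∃ (r s : S) (e : D), r ∈ 𝒜 (d + e) ∧ s ∈ 𝒜 e ∧ a r ≠ 0 ∧
    a s ≠ 0 ∧ b r * a s = u * (a r * b s)
  have hne : ∀ {d x}, x ∈ 𝒜 d → a x ≠ 0 → b x ≠ 0 := fun hx h h' => h ((hker _ _ hx).2 h')
  have huniq : ∀ d u u', R d u → R d u' → u = u' := by
    rintro d u u' ⟨r, s, e, hr, hs, hr0, hs0, h⟩ ⟨r', s', e', hr', hs', hr0', hs0', h'⟩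
    have h1 := SetLike.mul_mem_graded hr hs'
    have h2 := SetLike.mul_mem_graded hr' hs
    rw [add_right_comm] at h2
    have h3 := hab _ _ h1 _ h2
    rw [map_mul, map_mul, map_mul, map_mul] at h3
    refine Units.ext (mul_right_cancel₀ (mul_ne_zero (mul_ne_zero hr0 (hne hs hs0))
      (mul_ne_zero hr0' (hne hs' hs0'))) ?_)
    linear_combination (-(a r' * b s')) * h + (a r * b s) * h' - h3
  have hone : R 0 1 := ⟨1, 1, 0, by simpa using SetLike.one_mem_graded 𝒜,
    SetLike.one_mem_graded 𝒜, by simp, by simp, by simp⟩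
  have hmul : ∀ d d' u u', R d u → R d' u' → R (d + d') (u * u') := by
    rintro d d' u u' ⟨r, s, e, hr, hs, hr0, hs0, h⟩ ⟨r', s', e', hr', hs', hr0', hs0', h'⟩
    refine ⟨r * r', s * s', e + e', ?_, SetLike.mul_mem_graded hs hs', ?_, ?_, ?_⟩
    · rw [add_add_add_comm]
      exact SetLike.mul_mem_graded hr hr'
    · rw [map_mul]; exact mul_ne_zero hr0 hr0'
    · rw [map_mul]; exact mul_ne_zero hs0 hs0'
    · simp only [map_mul, Units.val_mul]
      linear_combination (b r' * a s') * h + (u * (a r * b s)) * h'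
  have hinv : ∀ d u, R d u → R (-d) u⁻¹ := by
    rintro d u ⟨r, s, e, hr, hs, hr0, hs0, h⟩
    refine ⟨s, r, d + e, by simpa using hs, hr, hs0, hr0, ?_⟩
    rw [Units.eq_inv_mul_iff_mul_eq]
    linear_combination -h
  let T : AddSubgroup D :=
    { carrier := {d | ∃ u, R d u}
      zero_mem' := ⟨1, hone⟩
      add_mem' := fun ⟨u, hu⟩ ⟨u', hu'⟩ => ⟨_, hmul _ _ _ _ hu hu'⟩
      neg_mem' := fun ⟨u, hu⟩ => ⟨_, hinv _ _ hu⟩ }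
  choose c hc using fun d : T => d.2
  let χ₀ : T →+ Additive Ωˣ := AddMonoidHom.mk' (fun d => Additive.ofMul (c d)) fun d d' =>
    congrArg Additive.ofMul (huniq _ _ _ (hc (d + d')) (hmul _ _ _ _ (hc d) (hc d')))
  -- The ratio is a character only on the subgroup `T` of degrees where some fraction survives;
  -- $\Omega^\times$ is divisible, hence injective, so it extends to $D$. On other degrees both
  -- homomorphisms vanish.
  obtain ⟨hdiv⟩ := divisible_additive_units Ω
  obtain ⟨χ, hχ⟩ := (Module.Baer.of_divisible (Additive Ωˣ)).extension_property_addMonoidHom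
    T.subtype T.subtype_injective χ₀
  refine ⟨χ, fun d x hx => ?_⟩
  by_cases hx0 : a x = 0
  · rw [hx0, (hker d x hx).1 hx0, zero_mul]
  have hR : R d (Units.mk0 (b x / a x) (div_ne_zero (hne hx hx0) hx0)) :=
    ⟨x, 1, 0, by simpa using hx, SetLike.one_mem_graded 𝒜, hx0, by simp, by
      simp [div_mul_cancel₀ _ hx0]⟩
  let d' : T := ⟨d, _, hR⟩
  have h1 : χ d = Additive.ofMul (c d') := DFunLike.congr_fun hχ d'
  rw [h1, toMul_ofMul, huniq _ _ _ (hc d') hR, Units.val_mk0, mul_div_cancel₀ _ hx0]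

/-- Two primes with the same homogeneous elements lie in the same orbit. -/
theorem quotMap_eq_of_homogeneousCore_eq {P P' : PrimeSpectrum S}
    (h : homogeneousCore 𝒜 P = homogeneousCore 𝒜 P') :
    (quotMap 𝒜).base P = (quotMap 𝒜).base P' := by
  obtain ⟨Ω, _, _, a, b, ha, hb, hab⟩ := exists_ringHom_of_homogeneousCore_eq h
  obtain ⟨χ, hχ⟩ := exists_character (𝒜 := 𝒜) (a := a) (b := b) (fun d x hx => by
    rw [← RingHom.mem_ker, ← RingHom.mem_ker, ha, hb]
    exact homogeneousCore_eq_iff.1 h x ⟨d, hx⟩) hab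
  let χ' : Multiplicative D →* Ω := (Units.coeHom Ω).comp (AddMonoidHom.toMultiplicativeLeft χ)
  -- The homomorphism $s\chi^d\mapsto a(s)\chi(d)$ restricts to $a$ along the projection and to $b$
  -- along the coaction, so its kernel is a point that the two arrows send to $P$ and $P'$.
  let φ : AddMonoidAlgebra S D →+* Ω :=
    AddMonoidAlgebra.liftNCRingHom a χ' fun _ _ => Commute.all _ _
  have hφ : ∀ (d : D) (x : S), φ (AddMonoidAlgebra.single d x) = a x * ((χ d).toMul : Ω) :=
    fun d x => AddMonoidAlgebra.liftNC_single _ _ _ _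
  have h1 : φ.comp AddMonoidAlgebra.singleZeroRingHom = a := by
    ext x
    refine (hφ 0 x).trans ?_
    simp
  have h2 : φ.comp (coaction 𝒜) = b := by
    ext x
    induction x using DirectSum.Decomposition.inductionOn 𝒜 with
    | zero => simp
    | @homogeneous d x => rw [RingHom.comp_apply, coaction_apply 𝒜 x.2, hφ, hχ d x x.2]
    | add x y hx hy => rw [map_add, map_add, hx, hy]
  let z : PrimeSpectrum (AddMonoidAlgebra S D) := PrimeSpectrum.comap φ ⊥
  have e1 : (prHom (D := D) (S := S)).base z = P := by
    refine PrimeSpectrum.ext ?_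
    rw [← ha, ← h1]
    rfl
  have e2 : (actHom 𝒜).base z = P' := by
    refine PrimeSpectrum.ext ?_
    rw [← hb, ← h2]
    rfl
  have := congrArg (fun f => f.base z) (coequalizer.condition (prHom (D := D) (S := S)) (actHom 𝒜))
  rw [← e1, ← e2]
  exact this

theorem theta_injective : Function.Injective (theta 𝒜) := by
  intro x y h
  obtain ⟨P, rfl⟩ := quotMap_surjective 𝒜 x
  obtain ⟨P', rfl⟩ := quotMap_surjective 𝒜 y
  exact quotMap_eq_of_homogeneousCore_eq
    (((theta_quotMap 𝒜 P).symm.trans h).trans (theta_quotMap 𝒜 P'))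

theorem theta_surjective : Function.Surjective (theta 𝒜) := fun p => by
  obtain ⟨P, rfl⟩ := exists_homogeneousCore_eq p
  exact ⟨_, theta_quotMap 𝒜 P⟩

end

section

/-! ### Sections of a coequalizer of (pre)sheafed spaces -/

/-- Sections over a coequalizer form the limit of sections over the diagram, and the component on
`Y` determines the one on `X`. -/
theorem coequalizer_π_c_app_injective {X Y : PresheafedSpace.{u, u+1, u} CommRingCat.{u}}
    (f g : X ⟶ Y)
    (U : Opens (coequalizer f g : PresheafedSpace.{u, u+1, u} CommRingCat.{u}).carrier) :
    Function.Injective ((coequalizer.π f g).c.app (op U)) := by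
  intro s t hst
  let F := parallelPair f g
  let e := PresheafedSpace.colimitPresheafObjIsoComponentwiseLimit F U
  have he : Function.Injective e.hom := (ConcreteCategory.bijective_of_isIso e.hom).1
  apply he
  have key : ∀ j, e.hom ≫ limit.π _ (op j) = (colimit.ι F j).c.app (op U) :=
    fun j => PresheafedSpace.colimitPresheafObjIsoComponentwiseLimit_hom_π F U j
  have hone :
      limit.π (PresheafedSpace.componentwiseDiagram F U) (op WalkingParallelPair.one) (e.hom s) =
      limit.π (PresheafedSpace.componentwiseDiagram F U) (op WalkingParallelPair.one)
        (e.hom t) := by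
    have h1 := ConcreteCategory.congr_hom (key WalkingParallelPair.one) s
    have h2 := ConcreteCategory.congr_hom (key WalkingParallelPair.one) t
    exact h1.trans (hst.trans h2.symm)
  refine Concrete.limit_ext _ _ _ fun j => ?_
  induction j with
  | op j =>
    cases j with
    | one => exact hone
    | zero =>
      have hw := limit.w (PresheafedSpace.componentwiseDiagram F U)
        (Quiver.Hom.op WalkingParallelPairHom.left)
      rw [← hw, CommRingCat.comp_apply, CommRingCat.comp_apply, hone]

/-- Sections over the coequalizer are the sections on `Y` with equal pull-backs. The two preimages
in `X` are equal only propositionally; `V` is a common name on which both pull-backs can be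
compared. -/
theorem exists_coequalizer_π_c_app_eq {X Y : PresheafedSpace.{u, u+1, u} CommRingCat.{u}}
    (f g : X ⟶ Y)
    (U : Opens (coequalizer f g : PresheafedSpace.{u, u+1, u} CommRingCat.{u}).carrier)
    (s : Y.presheaf.obj (op ((Opens.map (coequalizer.π f g).base).obj U)))
    {V : Opens X} (hf : V = (Opens.map f.base).obj ((Opens.map (coequalizer.π f g).base).obj U))
    (hg : V = (Opens.map g.base).obj ((Opens.map (coequalizer.π f g).base).obj U))
    (h : X.presheaf.map (homOfLE hf.le).op (f.c.app _ s) =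
      X.presheaf.map (homOfLE hg.le).op (g.c.app _ s)) :
    ∃ t, (coequalizer.π f g).c.app (op U) t = s := by
  let F := parallelPair f g
  let e := PresheafedSpace.colimitPresheafObjIsoComponentwiseLimit F U
  have key : ∀ j, e.hom ≫ limit.π _ (op j) = (colimit.ι F j).c.app (op U) :=
    fun j => PresheafedSpace.colimitPresheafObjIsoComponentwiseLimit_hom_π F U j
  let d := PresheafedSpace.componentwiseDiagram F U
  let E : Subring (d.obj (op WalkingParallelPair.one)) := RingHom.eqLocus
    (d.map (Quiver.Hom.op WalkingParallelPairHom.left)).hom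
    (d.map (Quiver.Hom.op WalkingParallelPairHom.right)).hom
  have hs : s ∈ E := by
    change d.map (Quiver.Hom.op WalkingParallelPairHom.left) s =
      d.map (Quiver.Hom.op WalkingParallelPairHom.right) s
    -- The diagram uses the preimage under the composite leg from `X`, a further form of `V`;
    -- restriction maps with the same endpoints coincide.
    have hV : V = (Opens.map (colimit.ι F WalkingParallelPair.zero).base).obj U := by
      have hw := colimit.w F WalkingParallelPairHom.left
      rw [hf, ← hw]
      rfl
    have h' := congrArg (X.presheaf.map (eqToHom (congrArg op hV))) h
    have comp : ∀ {W₁ W₂ W₃ : (Opens X)ᵒᵖ} (i : W₁ ⟶ W₂) (j : W₂ ⟶ W₃) (k : W₁ ⟶ W₃)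
        (x : X.presheaf.obj W₁), X.presheaf.map j (X.presheaf.map i x) = X.presheaf.map k x := by
      intro W₁ W₂ W₃ i j k x
      rw [← CommRingCat.comp_apply, ← Functor.map_comp]
      rfl
    exact (comp _ _ _ _).symm.trans (h'.trans (comp _ _ _ _))
  let app : ∀ j : WalkingParallelPair, CommRingCat.of E ⟶ d.obj (op j) := fun j => match j with
    | .one => CommRingCat.ofHom E.subtype
    | .zero => CommRingCat.ofHom E.subtype ≫ d.map (Quiver.Hom.op WalkingParallelPairHom.left)
  let c : Cone d :=
    { pt := CommRingCat.of E
      π :=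
        { app := fun j => app j.unop
          naturality := fun i j a => by
            have hnat : ∀ {i j : WalkingParallelPair} (a : j ⟶ i),
                𝟙 _ ≫ app j = app i ≫ d.map (Quiver.Hom.op a) := by
              intro i j a
              match i, j, a with
              | _, _, WalkingParallelPairHom.left => exact Category.id_comp _
              | _, _, WalkingParallelPairHom.right =>
                refine (Category.id_comp _).trans ?_
                ext x
                exact x.2
              | i, _, WalkingParallelPairHom.id _ =>
                refine (Category.id_comp _).trans ?_
                exact ((congrArg (app i ≫ ·) (d.map_id (op i))).trans (Category.comp_id _)).symm
            exact hnat a.unop } }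
  refine ⟨e.inv (limit.lift d c ⟨s, hs⟩), ?_⟩
  have h1 : e.inv ≫ (colimit.ι F WalkingParallelPair.one).c.app (op U) =
      limit.π _ (op WalkingParallelPair.one) :=
    (Iso.inv_comp_eq e).2 (key _).symm
  have h2 := ConcreteCategory.congr_hom h1 (limit.lift d c ⟨s, hs⟩)
  refine Eq.trans h2 ?_
  exact ConcreteCategory.congr_hom (limit.lift_π c (op WalkingParallelPair.one)) ⟨s, hs⟩

theorem c_app_injective_of_isColimit {X Y Q : PresheafedSpace.{u, u+1, u} CommRingCat.{u}}
    {f g : X ⟶ Y} {π : Y ⟶ Q} {w : f ≫ π = g ≫ π} (hπ : IsColimit (Cofork.ofπ π w))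
    (U : Opens Q.carrier) : Function.Injective (π.c.app (op U)) := by
  let e : coequalizer f g ≅ Q := (coequalizerIsCoequalizer f g).coconePointUniqueUpToIso hπ
  have he : coequalizer.π f g ≫ e.hom = π :=
    (coequalizerIsCoequalizer f g).comp_coconePointUniqueUpToIso_hom hπ .one
  -- With `e` opaque, `π` can be replaced by the standard coequalizer map followed by an
  -- isomorphism.
  clear_value e
  clear hπ
  subst he
  have he' : IsIso e.hom.c := inferInstance
  have : IsIso (e.hom.c.app (op U)) := NatIso.isIso_app_of_isIso _ _
  rw [PresheafedSpace.comp_c_app]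
  intro s t hst
  refine (ConcreteCategory.bijective_of_isIso (e.hom.c.app (op U))).1 ?_
  exact coequalizer_π_c_app_injective f g _ hst

theorem exists_c_app_eq_of_isColimit {X Y Q : PresheafedSpace.{u, u+1, u} CommRingCat.{u}}
    {f g : X ⟶ Y} {π : Y ⟶ Q} {w : f ≫ π = g ≫ π} (hπ : IsColimit (Cofork.ofπ π w))
    (U : Opens Q.carrier) (s : Y.presheaf.obj (op ((Opens.map π.base).obj U)))
    {V : Opens X} (hf : V = (Opens.map f.base).obj ((Opens.map π.base).obj U))
    (hg : V = (Opens.map g.base).obj ((Opens.map π.base).obj U))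
    (h : X.presheaf.map (homOfLE hf.le).op (f.c.app _ s) =
      X.presheaf.map (homOfLE hg.le).op (g.c.app _ s)) :
    ∃ t, π.c.app (op U) t = s := by
  let e : coequalizer f g ≅ Q := (coequalizerIsCoequalizer f g).coconePointUniqueUpToIso hπ
  have he : coequalizer.π f g ≫ e.hom = π :=
    (coequalizerIsCoequalizer f g).comp_coconePointUniqueUpToIso_hom hπ .one
  clear_value e
  clear hπ
  subst he
  have he' : IsIso e.hom.c := inferInstance
  have : IsIso (e.hom.c.app (op U)) := NatIso.isIso_app_of_isIso _ _
  obtain ⟨t, ht⟩ := exists_coequalizer_π_c_app_eq f g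
    ((Opens.map e.hom.base).obj U) s hf hg h
  obtain ⟨t, rfl⟩ := (ConcreteCategory.bijective_of_isIso (e.hom.c.app (op U))).2 t
  refine ⟨t, ?_⟩
  rw [PresheafedSpace.comp_c_app]
  exact ht

variable {D S : Type u} [AddCommGroup D] [DecidableEq D] [CommRing S]
variable (𝒜 : D → AddSubgroup S) [GradedRing 𝒜]

/-- The quotient morphism is a coequalizer of presheafed spaces. -/
def quotPresheafedIsColimit :
    IsColimit (Cofork.ofπ (f := (prHom (D := D) (S := S)).toShHom.hom)
      (g := (actHom 𝒜).toShHom.hom) (quotMap 𝒜).toShHom.hom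
      (congrArg (fun f => f.toShHom.hom) (coequalizer.condition (prHom (D := D) (S := S))
        (actHom 𝒜)))) :=
  isColimitCoforkMapOfIsColimit SheafedSpace.forgetToPresheafedSpace _
    (isColimitCoforkMapOfIsColimit LocallyRingedSpace.forgetToSheafedSpace _
      (coequalizerIsCoequalizer (prHom (D := D) (S := S)) (actHom 𝒜)))

end

section

/-! ### Localization maps -/

/-- `φ` is a localization homomorphism at the powers of `r`. -/
structure IsAwayHom {R B : Type*} [CommRing R] [CommRing B] (φ : R →+* B) (r : R) : Prop where
  isUnit : IsUnit (φ r)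
  surj : ∀ b, ∃ (n : ℕ) (a : R), b * φ r ^ n = φ a
  exists_of_eq_zero : ∀ a, φ a = 0 → ∃ n : ℕ, r ^ n * a = 0

theorem IsAwayHom.isLocalization {R B : Type*} [CommRing R] [CommRing B] [Algebra R B] {r : R}
    (h : IsAwayHom (algebraMap R B) r) : IsLocalization.Away r B where
  map_units := by
    rintro ⟨_, n, rfl⟩
    rw [map_pow]
    exact h.isUnit.pow n
  surj b := by
    obtain ⟨n, a, hb⟩ := h.surj b
    exact ⟨(a, ⟨r ^ n, n, rfl⟩), by rw [map_pow, hb]⟩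
  exists_of_eq {x y} hxy := by
    obtain ⟨n, hn⟩ := h.exists_of_eq_zero (x - y) (by rw [map_sub, hxy, sub_self])
    exact ⟨⟨r ^ n, n, rfl⟩, sub_eq_zero.1 (by rw [← mul_sub]; exact hn)⟩

theorem isAwayHom_algebraMap {R : Type*} (B : Type*) [CommRing R] [CommRing B] [Algebra R B] (r : R)
    [IsLocalization.Away r B] : IsAwayHom (algebraMap R B) r where
  isUnit := IsLocalization.Away.algebraMap_isUnit r
  surj b := by
    obtain ⟨⟨a, _, n, rfl⟩, h⟩ := IsLocalization.surj (Submonoid.powers r) b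
    exact ⟨n, a, by rw [← map_pow]; exact h⟩
  exists_of_eq_zero a ha := by
    obtain ⟨⟨_, n, rfl⟩, h⟩ := (IsLocalization.map_eq_zero_iff (Submonoid.powers r) B a).1 ha
    exact ⟨n, h⟩

theorem isAwayHom_of_toAlgebra {R B : Type*} [CommRing R] [CommRing B] {φ : R →+* B} {r : R}
    (h : @IsLocalization.Away R _ r B _ φ.toAlgebra) : IsAwayHom φ r :=
  @isAwayHom_algebraMap R B _ _ φ.toAlgebra r h

/-- Localization commutes with equalizers. -/
theorem IsAwayHom.of_equalizer {A B C A' B' C' : Type*} [CommRing A] [CommRing B] [CommRing C]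
    [CommRing A'] [CommRing B'] [CommRing C'] {ι : A →+* B} {p q : B →+* C} {ι' : A' →+* B'}
    {p' q' : B' →+* C'} {ρA : A →+* A'} {ρB : B →+* B'} {ρC : C →+* C'}
    (hι : ∀ a, ρB (ι a) = ι' (ρA a)) (hp : ∀ b, ρC (p b) = p' (ρB b))
    (hq : ∀ b, ρC (q b) = q' (ρB b)) (inj : Function.Injective ι) (inj' : Function.Injective ι')
    (hpq : ∀ a, p (ι a) = q (ι a)) (hpq' : ∀ a, p' (ι' a) = q' (ι' a))
    (hex : ∀ b, p b = q b → ∃ a, ι a = b) (hex' : ∀ b, p' b = q' b → ∃ a, ι' a = b) {r : A}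
    (hB : IsAwayHom ρB (ι r)) (hC : IsAwayHom ρC (p (ι r))) : IsAwayHom ρA r where
  isUnit := by
    have hu := hB.isUnit
    rw [hι] at hu
    obtain ⟨b, hb⟩ := hu.exists_right_inv
    have hpu : IsUnit (p' (ι' (ρA r))) := hu.map p'
    -- An inverse of an element equalized by $p'$ and $q'$ is itself equalized, so it comes from
    -- $A'$.
    obtain ⟨a, rfl⟩ := hex' b (hpu.mul_left_cancel (by
      rw [← map_mul, hb, hpq', ← map_mul, hb, map_one, map_one]))
    exact IsUnit.of_mul_eq_one a (inj' (by rw [map_mul, hb, map_one]))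
  surj a' := by
    obtain ⟨n, b, hb⟩ := hB.surj (ι' a')
    -- The difference $p(b)-q(b)$ dies in $C'$, so a power of $r$ kills it; multiplying $b$ by that
    -- power lands in $A$.
    obtain ⟨m, hm⟩ := hC.exists_of_eq_zero (p b - q b) (by
      rw [map_sub, hp, hq, ← hb, hι, ← map_pow, ← map_mul, hpq', sub_self])
    obtain ⟨a, ha⟩ := hex (ι r ^ m * b) (by
      rw [← sub_eq_zero, map_mul, map_mul, map_pow, map_pow, ← hpq, ← mul_sub, hm])
    refine ⟨n + m, a, inj' ?_⟩
    rw [← hι a, ha, map_mul ι', map_mul ρB, ← hb, map_pow ρB, map_pow ι', hι]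
    ring
  exists_of_eq_zero a ha := by
    obtain ⟨n, hn⟩ := hB.exists_of_eq_zero (ι a) (by rw [hι, ha, map_zero])
    exact ⟨n, inj (by rw [map_mul, map_pow, hn, map_zero])⟩

theorem exists_ringHom_lift {A B R : Type*} [CommRing A] [CommRing B] [CommRing R] (ι : A →+* B)
    (hι : Function.Injective ι) (g : R →+* B) (hg : ∀ x, ∃ a, ι a = g x) :
    ∃ ψ : R →+* A, ∀ x, ι (ψ x) = g x := by
  choose ψ hψ using hg
  exact ⟨{ toFun := ψ
           map_one' := hι (by rw [hψ, map_one, map_one])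
           map_mul' := fun x y => hι (by rw [hψ, map_mul, map_mul, hψ, hψ])
           map_zero' := hι (by rw [hψ, map_zero, map_zero])
           map_add' := fun x y => hι (by rw [hψ, map_add, map_add, hψ, hψ]) }, hψ⟩

/-! ### Sections of affine schemes -/

/-- The canonical homomorphism from a ring to the sections over an open subset of its spectrum. -/
def toSections (R : CommRingCat.{u}) (U : (Spec R).Opens) : R →+* Γ(Spec R, U) :=
  ((Scheme.ΓSpecIso R).inv ≫ (Spec R).presheaf.map (homOfLE le_top).op).hom

theorem isAwayHom_map {X : Scheme.{u}} {U V : X.Opens} (hU : IsAffineOpen U) (i : V ≤ U)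
    (r : Γ(X, U)) (hV : V = X.basicOpen r) :
    IsAwayHom (X.presheaf.map (homOfLE i).op).hom r :=
  isAwayHom_of_toAlgebra (hU.isLocalization_of_eq_basicOpen r (homOfLE i) hV)

theorem isAwayHom_toSections {R : CommRingCat.{u}} {U : (Spec R).Opens} (r : R)
    (hU : U = PrimeSpectrum.basicOpen r) : IsAwayHom (toSections R U) r := by
  have h := isAwayHom_map (isAffineOpen_top (Spec R)) (le_top : U ≤ ⊤)
    ((Scheme.ΓSpecIso R).inv r) (hU.trans (basicOpen_eq_of_affine r).symm)
  have hbij := ConcreteCategory.bijective_of_isIso (Scheme.ΓSpecIso R).inv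
  refine ⟨h.isUnit, fun b => ?_, fun a ha => ?_⟩
  · obtain ⟨n, a, hb⟩ := h.surj b
    obtain ⟨a, rfl⟩ := hbij.2 a
    exact ⟨n, a, hb⟩
  · obtain ⟨n, hn⟩ := h.exists_of_eq_zero _ ha
    refine ⟨n, hbij.1 ?_⟩
    rw [map_mul, map_pow, map_zero]
    exact hn

theorem toSections_res (R : CommRingCat.{u}) {U V : (Spec R).Opens} (i : V ≤ U) (x : R) :
    (Spec R).presheaf.map (homOfLE i).op (toSections R U x) = toSections R V x := by
  change ((((Scheme.ΓSpecIso R).inv ≫ (Spec R).presheaf.map _) ≫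
    (Spec R).presheaf.map (homOfLE i).op)) x = _
  rw [Category.assoc, ← Functor.map_comp]
  rfl

theorem app_toSections {R R' : CommRingCat.{u}} (φ : R ⟶ R') (U : (Spec R).Opens) (x : R) :
    (Spec.map φ).app U (toSections R U x) = toSections R' (Spec.map φ ⁻¹ᵁ U) (φ x) := by
  change (((Scheme.ΓSpecIso R).inv ≫ (Spec R).presheaf.map _) ≫ (Spec.map φ).app U) x =
    (φ ≫ (Scheme.ΓSpecIso R').inv ≫ (Spec R').presheaf.map _) x
  rw [← Category.assoc φ, Scheme.ΓSpecIso_inv_naturality, Category.assoc, Category.assoc,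
    Scheme.Hom.naturality]
  rfl

end

section

variable {D S : Type u} [AddCommGroup D] [DecidableEq D] [CommRing S]
variable (𝒜 : D → AddSubgroup S) [GradedRing 𝒜]

/-! ### Sections of `Q(S)` -/

theorem quotMap_app_injective (U : Opens (quot 𝒜).toTopCat) :
    Function.Injective ((quotMap 𝒜).c.app (op U)) :=
  c_app_injective_of_isColimit (quotPresheafedIsColimit 𝒜) U

/-- The inverse image in `Spec S` of an open subset of `Q(S)`. -/
abbrev quotPre (U : Opens (quot 𝒜).toTopCat) : (Spec (CommRingCat.of S)).Opens :=
  (Opens.map (quotMap 𝒜).base).obj U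

/-- The projection as a morphism of schemes. -/
abbrev prSpec : Spec (CommRingCat.of (AddMonoidAlgebra S D)) ⟶ Spec (CommRingCat.of S) :=
  Spec.map (CommRingCat.ofHom (AddMonoidAlgebra.singleZeroRingHom : S →+* AddMonoidAlgebra S D))

/-- The action as a morphism of schemes. -/
abbrev actSpec : Spec (CommRingCat.of (AddMonoidAlgebra S D)) ⟶ Spec (CommRingCat.of S) :=
  Spec.map (CommRingCat.ofHom (coaction 𝒜))

theorem prSpec_preimage_eq (U : Opens (quot 𝒜).toTopCat) :
    prSpec (D := D) (S := S) ⁻¹ᵁ (quotPre 𝒜 U) = actSpec 𝒜 ⁻¹ᵁ (quotPre 𝒜 U) := by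
  have h := congrArg (fun f => (Opens.map f.base).obj U)
    (coequalizer.condition (prHom (D := D) (S := S)) (actHom 𝒜))
  exact h

/-- Pull-back of sections along the projection. -/
def prSections (U : Opens (quot 𝒜).toTopCat) : Γ(Spec (CommRingCat.of S), quotPre 𝒜 U) →+*
    Γ(Spec (CommRingCat.of (AddMonoidAlgebra S D)), prSpec (D := D) (S := S) ⁻¹ᵁ (quotPre 𝒜 U)) :=
  ((prSpec (D := D) (S := S)).app (quotPre 𝒜 U)).hom

/-- Pull-back of sections along the action. -/
def actSections (U : Opens (quot 𝒜).toTopCat) : Γ(Spec (CommRingCat.of S), quotPre 𝒜 U) →+*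
    Γ(Spec (CommRingCat.of (AddMonoidAlgebra S D)), prSpec (D := D) (S := S) ⁻¹ᵁ (quotPre 𝒜 U)) :=
  ((actSpec 𝒜).app (quotPre 𝒜 U) ≫ (Spec (CommRingCat.of (AddMonoidAlgebra S D))).presheaf.map
    (homOfLE (prSpec_preimage_eq 𝒜 U).le).op).hom

/-- Pull-back of sections along the quotient map. -/
def quotSections (U : Opens (quot 𝒜).toTopCat) : (quot 𝒜).presheaf.obj (op U) →+*
    Γ(Spec (CommRingCat.of S), quotPre 𝒜 U) :=
  ((quotMap 𝒜).c.app (op U)).hom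

theorem prSections_quotSections (U : Opens (quot 𝒜).toTopCat) (s : (quot 𝒜).presheaf.obj (op U)) :
    prSections 𝒜 U (quotSections 𝒜 U s) = actSections 𝒜 U (quotSections 𝒜 U s) := by
  have h := PresheafedSpace.congr_app (congrArg (fun f => f.toShHom.hom)
    (coequalizer.condition (prHom (D := D) (S := S)) (actHom 𝒜))) (op U)
  exact ConcreteCategory.congr_hom h s

theorem exists_quotSections_eq (U : Opens (quot 𝒜).toTopCat)
    (s : Γ(Spec (CommRingCat.of S), quotPre 𝒜 U)) (h : prSections 𝒜 U s = actSections 𝒜 U s) :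
    ∃ t, quotSections 𝒜 U t = s := by
  refine exists_c_app_eq_of_isColimit (quotPresheafedIsColimit 𝒜) U s rfl
    (prSpec_preimage_eq 𝒜 U) (Eq.trans ?_ h)
  exact ConcreteCategory.congr_hom ((Spec (CommRingCat.of (AddMonoidAlgebra S D))).presheaf.map_id _)
    ((prSpec (D := D) (S := S)).app (quotPre 𝒜 U) s)

theorem quotSections_injective (U : Opens (quot 𝒜).toTopCat) :
    Function.Injective (quotSections 𝒜 U) :=
  quotMap_app_injective 𝒜 U

/-- Sections of `Q(S)` over `V` and over the nonvanishing locus of a section, if `V` has affine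
inverse image. -/
theorem isAwayHom_quot_map {U V : Opens (quot 𝒜).toTopCat} (i : V ≤ U)
    (hU : IsAffineOpen (quotPre 𝒜 U)) (r : (quot 𝒜).presheaf.obj (op U))
    (hV : V = (quot 𝒜).toRingedSpace.basicOpen r) :
    IsAwayHom ((quot 𝒜).presheaf.map (homOfLE i).op).hom r := by
  have i' : quotPre 𝒜 V ≤ quotPre 𝒜 U := fun x hx => i hx
  have i'' : prSpec (D := D) (S := S) ⁻¹ᵁ (quotPre 𝒜 V) ≤
    prSpec (D := D) (S := S) ⁻¹ᵁ (quotPre 𝒜 U) := fun x hx => i hx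
  have hB : quotPre 𝒜 V = (Spec (CommRingCat.of S)).basicOpen (quotSections 𝒜 U r) := by
    rw [hV]
    exact LocallyRingedSpace.preimage_basicOpen (quotMap 𝒜) r
  have hC : prSpec (D := D) (S := S) ⁻¹ᵁ (quotPre 𝒜 V) =
      (Spec (CommRingCat.of (AddMonoidAlgebra S D))).basicOpen
        (prSections 𝒜 U (quotSections 𝒜 U r)) := by
    rw [hB]
    exact Scheme.preimage_basicOpen _ _
  -- The rows are the equalizer diagrams of sections over `U` and over `V`; on both affine preimages
  -- restriction to the nonvanishing locus is a localization.
  refine IsAwayHom.of_equalizer (ι := quotSections 𝒜 U) (ι' := quotSections 𝒜 V)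
    (p := prSections 𝒜 U) (q := actSections 𝒜 U) (p' := prSections 𝒜 V) (q' := actSections 𝒜 V)
    (ρB := ((Spec (CommRingCat.of S)).presheaf.map (homOfLE i').op).hom)
    (ρC := ((Spec (CommRingCat.of (AddMonoidAlgebra S D))).presheaf.map (homOfLE i'').op).hom)
    ?_ ?_ ?_ (quotSections_injective 𝒜 U) (quotSections_injective 𝒜 V)
    (prSections_quotSections 𝒜 U) (prSections_quotSections 𝒜 V) (exists_quotSections_eq 𝒜 U)
    (exists_quotSections_eq 𝒜 V) (isAwayHom_map hU i' _ hB)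
    (isAwayHom_map (hU.preimage _) i'' _ hC)
  · intro a
    exact (ConcreteCategory.congr_hom ((quotMap 𝒜).c.naturality (homOfLE i).op) a).symm
  · intro b
    exact (ConcreteCategory.congr_hom ((prSpec (D := D) (S := S)).naturality (homOfLE i').op) b).symm
  · intro b
    have h := (actSpec 𝒜).naturality (homOfLE i').op
    have h' := h =≫ (Spec (CommRingCat.of (AddMonoidAlgebra S D))).presheaf.map
      (homOfLE (prSpec_preimage_eq 𝒜 V).le).op
    simp only [Category.assoc, ← Functor.map_comp] at h'
    refine Eq.trans ?_ (ConcreteCategory.congr_hom h' b).symm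
    change ((Spec (CommRingCat.of (AddMonoidAlgebra S D))).presheaf.map
      (homOfLE (prSpec_preimage_eq 𝒜 U).le).op ≫
      (Spec (CommRingCat.of (AddMonoidAlgebra S D))).presheaf.map (homOfLE i'').op)
        ((actSpec 𝒜).app (quotPre 𝒜 U) b) = _
    rw [← Functor.map_comp]
    rfl

/-! ### Sections over the charts -/

theorem isOpen_notMem {f : S} (hf : SetLike.IsHomogeneousElem 𝒜 f) :
    IsOpen {p : DSpec 𝒜 | f ∉ p.asIdeal} := by
  have : {p : DSpec 𝒜 | f ∉ p.asIdeal} = (zeroLocus 𝒜 {f})ᶜ := by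
    ext p
    simp [zeroLocus]
  rw [this]
  refine (isClosed_zeroLocus 𝒜 ?_).isOpen_compl
  rintro x rfl
  exact hf

/-- The open subset of `Q(S)` defined by a homogeneous element. -/
def chartOpen {f : S} (hf : SetLike.IsHomogeneousElem 𝒜 f) : Opens (quot 𝒜).toTopCat where
  carrier := chartSet 𝒜 f
  is_open' := by
    rw [chartSet_eq 𝒜 hf]
    exact (isOpen_notMem 𝒜 hf).preimage (theta 𝒜).hom.continuous

theorem quotMap_mem_chartSet_iff {f : S} (hf : SetLike.IsHomogeneousElem 𝒜 f)
    (P : PrimeSpectrum S) : (quotMap 𝒜).base P ∈ chartSet 𝒜 f ↔ f ∉ P.asIdeal := by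
  rw [chartSet_eq 𝒜 hf]
  change f ∉ (theta 𝒜 ((quotMap 𝒜).base P)).asIdeal ↔ _
  rw [show theta 𝒜 ((quotMap 𝒜).base P) = homogeneousCore 𝒜 P from theta_quotMap 𝒜 P,
    mem_homogeneousCore 𝒜 hf]

theorem quotPre_chartOpen {f : S} (hf : SetLike.IsHomogeneousElem 𝒜 f) :
    quotPre 𝒜 (chartOpen 𝒜 hf) = PrimeSpectrum.basicOpen f :=
  Opens.ext (Set.ext fun P => quotMap_mem_chartSet_iff 𝒜 hf P)

theorem isAffineOpen_quotPre_chartOpen {f : S} (hf : SetLike.IsHomogeneousElem 𝒜 f) :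
    IsAffineOpen (quotPre 𝒜 (chartOpen 𝒜 hf)) := by
  rw [quotPre_chartOpen]
  exact IsAffineOpen.Spec_basicOpen (R := CommRingCat.of S) f

theorem isAwayHom_toSections_chartOpen {f : S} (hf : SetLike.IsHomogeneousElem 𝒜 f) :
    IsAwayHom (toSections (CommRingCat.of S) (quotPre 𝒜 (chartOpen 𝒜 hf))) f :=
  isAwayHom_toSections (R := CommRingCat.of S) f (quotPre_chartOpen 𝒜 hf)

/-- The canonical homomorphism from `S_f` to the sections over `{P | f ∉ P}`. -/
def awaySections {f : S} (hf : SetLike.IsHomogeneousElem 𝒜 f) :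
    Localization.Away f →+* Γ(Spec (CommRingCat.of S), quotPre 𝒜 (chartOpen 𝒜 hf)) :=
  Localization.awayLift _ f (isAwayHom_toSections_chartOpen 𝒜 hf).isUnit

theorem awaySections_algebraMap {f : S} (hf : SetLike.IsHomogeneousElem 𝒜 f) (x : S) :
    awaySections 𝒜 hf (algebraMap S _ x) = toSections (CommRingCat.of S) _ x :=
  IsLocalization.lift_eq _ _

theorem awaySections_bijective {f : S} (hf : SetLike.IsHomogeneousElem 𝒜 f) :
    Function.Bijective (awaySections 𝒜 hf) := by
  have h := isAwayHom_toSections_chartOpen 𝒜 hf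
  constructor
  · rw [injective_iff_map_eq_zero]
    intro y hy
    obtain ⟨⟨x, _, n, rfl⟩, hx⟩ := IsLocalization.surj (Submonoid.powers f) y
    have h0 : toSections (CommRingCat.of S) (quotPre 𝒜 (chartOpen 𝒜 hf)) x = 0 := by
      rw [← awaySections_algebraMap, ← hx, map_mul, hy, zero_mul]
    obtain ⟨m, hm⟩ := h.exists_of_eq_zero x h0
    have hx0 : algebraMap S (Localization.Away f) x = 0 :=
      (IsLocalization.map_eq_zero_iff (Submonoid.powers f) _ x).2 ⟨⟨f ^ m, m, rfl⟩, hm⟩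
    refine (IsLocalization.map_units (Localization.Away f)
      (⟨f ^ n, n, rfl⟩ : Submonoid.powers f)).mul_left_injective ?_
    exact hx.trans (hx0.trans (zero_mul _).symm)
  · intro b
    obtain ⟨n, a, hb⟩ := h.surj b
    refine ⟨Localization.mk a (⟨f ^ n, n, rfl⟩ : Submonoid.powers f), ?_⟩
    refine (h.isUnit.pow n).mul_left_injective ?_
    change _ * _ = _ * _
    rw [hb, ← map_pow, ← awaySections_algebraMap, ← awaySections_algebraMap, ← map_mul]
    congr 1
    rw [Localization.mk_eq_mk']
    exact IsLocalization.mk'_spec _ a (⟨f ^ n, n, rfl⟩ : Submonoid.powers f)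

theorem prSections_toSections (U : Opens (quot 𝒜).toTopCat) (x : S) :
    prSections 𝒜 U (toSections (CommRingCat.of S) _ x) =
      toSections (CommRingCat.of (AddMonoidAlgebra S D)) _ (AddMonoidAlgebra.single 0 x) :=
  app_toSections (CommRingCat.ofHom (AddMonoidAlgebra.singleZeroRingHom :
    S →+* AddMonoidAlgebra S D)) (quotPre 𝒜 U) x

theorem actSections_toSections (U : Opens (quot 𝒜).toTopCat) (x : S) :
    actSections 𝒜 U (toSections (CommRingCat.of S) _ x) =
      toSections (CommRingCat.of (AddMonoidAlgebra S D)) _ (coaction 𝒜 x) := by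
  have h := app_toSections (CommRingCat.ofHom (coaction 𝒜)) (quotPre 𝒜 U) x
  change (Spec (CommRingCat.of (AddMonoidAlgebra S D))).presheaf.map _
    ((actSpec 𝒜).app (quotPre 𝒜 U) (toSections (CommRingCat.of S) _ x)) = _
  rw [h]
  exact toSections_res (CommRingCat.of (AddMonoidAlgebra S D)) _ _

/-- After mapping sections over the preimage to $S_f[D]$, the two pull-backs of $y$ become $y\chi^0$
and the coaction of $y$; they agree only in degree zero. -/
theorem awaySections_invariant_iff {f : S} (hf : SetLike.IsHomogeneousElem 𝒜 f)
    (y : Localization.Away f) :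
    prSections 𝒜 (chartOpen 𝒜 hf) (awaySections 𝒜 hf y) =
      actSections 𝒜 (chartOpen 𝒜 hf) (awaySections 𝒜 hf y) ↔
    y ∈ (algebraMap (HomogeneousLocalization.Away 𝒜 f) (Localization.Away f)).range := by
  obtain ⟨e, he⟩ := id hf
  constructor
  · intro h
    have hC : IsAwayHom (toSections (CommRingCat.of (AddMonoidAlgebra S D))
        (prSpec (D := D) (S := S) ⁻¹ᵁ (quotPre 𝒜 (chartOpen 𝒜 hf))))
        (AddMonoidAlgebra.single 0 f) := by
      refine isAwayHom_toSections (R := CommRingCat.of (AddMonoidAlgebra S D)) _ ?_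
      rw [quotPre_chartOpen]
      rfl
    let m : AddMonoidAlgebra S D →+* AddMonoidAlgebra (Localization.Away f) D :=
      AddMonoidAlgebra.mapRingHom D (algebraMap S (Localization.Away f))
    let _ := (toSections (CommRingCat.of (AddMonoidAlgebra S D))
        (prSpec (D := D) (S := S) ⁻¹ᵁ (quotPre 𝒜 (chartOpen 𝒜 hf)))).toAlgebra
    have hloc := hC.isLocalization
    have hmu : IsUnit (m (AddMonoidAlgebra.single 0 f)) := by
      rw [AddMonoidAlgebra.mapRingHom_single]
      exact (IsLocalization.Away.algebraMap_isUnit (S := Localization.Away f) f).map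
        (AddMonoidAlgebra.singleZeroRingHom :
          Localization.Away f →+* AddMonoidAlgebra (Localization.Away f) D)
    -- Only a homomorphism to $S_f[D]$ compatible with $S[D]$ is needed here, not that it is an
    -- isomorphism.
    let γ := IsLocalization.Away.lift (S := Γ(Spec (CommRingCat.of (AddMonoidAlgebra S D)),
      prSpec (D := D) (S := S) ⁻¹ᵁ (quotPre 𝒜 (chartOpen 𝒜 hf)))) _ hmu
    have hγ : ∀ x, γ (toSections (CommRingCat.of (AddMonoidAlgebra S D)) _ x) = m x :=
      fun x => IsLocalization.Away.lift_eq _ hmu x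
    have h1 : (γ.comp (prSections 𝒜 (chartOpen 𝒜 hf))).comp (awaySections 𝒜 hf) =
        (AddMonoidAlgebra.singleZeroRingHom :
          Localization.Away f →+* AddMonoidAlgebra (Localization.Away f) D) := by
      refine IsLocalization.ringHom_ext (Submonoid.powers f) (RingHom.ext fun x => ?_)
      simp only [RingHom.comp_apply]
      rw [awaySections_algebraMap, prSections_toSections, hγ]
      exact AddMonoidAlgebra.mapRingHom_single _ _ _
    have h2 : (γ.comp (actSections 𝒜 (chartOpen 𝒜 hf))).comp (awaySections 𝒜 hf) =
        coactionAway 𝒜 hf := by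
      refine IsLocalization.ringHom_ext (Submonoid.powers f) (RingHom.ext fun x => ?_)
      simp only [RingHom.comp_apply]
      rw [awaySections_algebraMap, actSections_toSections, hγ, coactionAway_algebraMap]
    refine mem_range_of_coactionAway_eq 𝒜 hf ?_
    exact (RingHom.congr_fun h2 y).symm.trans
      ((congrArg γ h).symm.trans (RingHom.congr_fun h1 y))
  · rintro ⟨x, rfl⟩
    obtain ⟨k, a, ha, rfl⟩ := HomogeneousLocalization.Away.mk_surjective 𝒜 he x
    have hspec : Localization.mk a (⟨f ^ k, k, rfl⟩ : Submonoid.powers f) *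
        algebraMap S (Localization.Away f) (f ^ k) = algebraMap S (Localization.Away f) a := by
      rw [Localization.mk_eq_mk']
      exact IsLocalization.mk'_spec _ a (⟨f ^ k, k, rfl⟩ : Submonoid.powers f)
    change prSections 𝒜 (chartOpen 𝒜 hf) (awaySections 𝒜 hf (Localization.mk a _)) =
      actSections 𝒜 (chartOpen 𝒜 hf) (awaySections 𝒜 hf (Localization.mk a _))
    have hu : IsUnit (actSections 𝒜 (chartOpen 𝒜 hf) (awaySections 𝒜 hf
        (algebraMap S (Localization.Away f) (f ^ k)))) := by
      rw [map_pow]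
      exact (((IsLocalization.Away.algebraMap_isUnit f).pow k).map _).map _
    refine hu.mul_left_injective ?_
    change _ * _ = _ * _
    rw [← map_mul, ← map_mul, hspec, awaySections_algebraMap, awaySections_algebraMap,
      actSections_toSections, actSections_toSections, coaction_apply 𝒜 ha,
      coaction_apply 𝒜 (SetLike.pow_mem_graded k he)]
    -- Numerator and denominator of $a/f^k$ have the same degree $ke$, so the coaction multiplies
    -- both by the same $\chi^{ke}$, which cancels.
    have hsingle : ∀ b : S, (AddMonoidAlgebra.single (k • e) b : AddMonoidAlgebra S D) =
        AddMonoidAlgebra.single 0 b * AddMonoidAlgebra.single (k • e) 1 := fun b => by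
      rw [AddMonoidAlgebra.single_mul_single, zero_add, mul_one]
    rw [hsingle a, hsingle (f ^ k), map_mul, map_mul, ← mul_assoc, ← prSections_toSections,
      ← prSections_toSections, ← awaySections_algebraMap, ← awaySections_algebraMap, ← map_mul,
      ← map_mul, hspec]

/-- The sections of `Q(S)` over the chart defined by `f` are the elements of `S_(f)`. -/
theorem exists_chartSections {f : S} (hf : SetLike.IsHomogeneousElem 𝒜 f) :
    ∃ ψ : HomogeneousLocalization.Away 𝒜 f →+* (quot 𝒜).presheaf.obj (op (chartOpen 𝒜 hf)),
      Function.Bijective ψ ∧ ∀ x, quotSections 𝒜 _ (ψ x) =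
        awaySections 𝒜 hf (algebraMap _ (Localization.Away f) x) := by
  obtain ⟨ψ, hψ⟩ := exists_ringHom_lift (quotSections 𝒜 (chartOpen 𝒜 hf))
    (quotSections_injective 𝒜 _) ((awaySections 𝒜 hf).comp
      (algebraMap (HomogeneousLocalization.Away 𝒜 f)
      (Localization.Away f)))
    fun x => exists_quotSections_eq 𝒜 _ _ ((awaySections_invariant_iff 𝒜 hf _).2 ⟨x, rfl⟩)
  refine ⟨ψ, ⟨fun x y h => ?_, fun t => ?_⟩, hψ⟩
  · refine algebraMap_degreeZero_injective 𝒜 f ((awaySections_bijective 𝒜 hf).1 ?_)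
    exact (hψ x).symm.trans ((congrArg _ h).trans (hψ y))
  · obtain ⟨y, hy⟩ := (awaySections_bijective 𝒜 hf).2 (quotSections 𝒜 _ t)
    obtain ⟨x, rfl⟩ := (awaySections_invariant_iff 𝒜 hf y).1
      (by rw [hy]; exact prSections_quotSections 𝒜 _ t)
    exact ⟨x, quotSections_injective 𝒜 _ ((hψ x).trans hy)⟩

end

section

/-! ### A criterion for affineness of locally ringed spaces -/

theorem IsAwayHom.bijective {R B B' : Type*} [CommRing R] [CommRing B] [CommRing B']
    {φ : R →+* B} {φ' : R →+* B'} {r : R} (h : IsAwayHom φ r) (h' : IsAwayHom φ' r)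
    (c : B →+* B') (hc : ∀ x, c (φ x) = φ' x) : Function.Bijective c := by
  constructor
  · rw [injective_iff_map_eq_zero]
    intro b hb
    obtain ⟨n, a, hba⟩ := h.surj b
    have ha : φ' a = 0 := by rw [← hc, ← hba, map_mul, hb, zero_mul]
    obtain ⟨m, hm⟩ := h'.exists_of_eq_zero a ha
    have h0 : b * φ r ^ n * φ r ^ m = 0 := by
      rw [hba, mul_comm, ← map_pow, ← map_mul, hm, map_zero]
    rw [mul_assoc, ← pow_add] at h0
    exact (h.isUnit.pow (n + m)).mul_left_injective (h0.trans (zero_mul _).symm)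
  · intro b'
    obtain ⟨n, a, hb⟩ := h'.surj b'
    obtain ⟨v, hv⟩ := (h.isUnit.pow n).exists_right_inv
    refine ⟨φ a * v, (h'.isUnit.pow n).mul_left_injective ?_⟩
    change c (φ a * v) * φ' r ^ n = b' * φ' r ^ n
    rw [hb, ← hc r, ← map_pow, ← map_mul, mul_assoc, mul_comm v, hv, mul_one, hc]

/-- Stalks can be computed on a basis, and isomorphisms of sheaves are detected on stalks. -/
theorem isIso_of_bijective_on_basis {X : TopCat.{u}} {F G : TopCat.Sheaf CommRingCat.{u} X}
    (α : F ⟶ G) {B : Set (Opens X)} (hB : Opens.IsBasis B)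
    (h : ∀ U ∈ B, Function.Bijective (α.hom.app (op U))) : IsIso α := by
  have (x : X) : IsIso ((TopCat.Presheaf.stalkFunctor CommRingCat x).map α.hom) := by
    rw [ConcreteCategory.isIso_iff_bijective]
    refine ⟨TopCat.Presheaf.stalkFunctor_map_injective_of_isBasis hB (fun U hU => (h U hU).1) x,
      fun t => ?_⟩
    obtain ⟨U, hxU, hU, s, rfl⟩ := TopCat.Presheaf.exists_mem_germ_eq_of_isBasis hB _ x t
    obtain ⟨s, rfl⟩ := (h U hU).2 s
    exact ⟨F.presheaf.germ U x hxU s, TopCat.Presheaf.stalkFunctor_map_germ_apply U x hxU α.hom s⟩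
  exact TopCat.Presheaf.isIso_of_stalkFunctor_map_iso α

/-- Over the basic open set of $r$ both sheaves have a localization of $\Gamma(X)$ at $r$ as
sections, and the comparison map respects $\Gamma(X)$. -/
theorem isIso_toΓSpec (X : LocallyRingedSpace.{u}) (h : IsHomeomorph X.toΓSpec.base)
    (h' : ∀ (r : LocallyRingedSpace.Γ.obj (op X)) (V : Opens X.toTopCat),
      V = X.toRingedSpace.basicOpen r →
      IsAwayHom (X.presheaf.map (homOfLE (le_top : V ≤ ⊤)).op).hom r) :
    IsIso X.toΓSpec := by
  have hbase : IsIso X.toΓSpec.base := (TopCat.isIso_iff_isHomeomorph _).2 h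
  have hc : IsIso X.toΓSpec.c := by
    let α : (⟨_, (Spec.locallyRingedSpaceObj (LocallyRingedSpace.Γ.obj (op X))).IsSheaf⟩ :
        TopCat.Sheaf CommRingCat.{u} _) ⟶
        ⟨_, TopCat.Sheaf.pushforward_sheaf_of_sheaf X.toΓSpec.base X.IsSheaf⟩ := ⟨X.toΓSpec.c⟩
    have : IsIso α := by
      refine isIso_of_bijective_on_basis α PrimeSpectrum.isBasis_basic_opens ?_
      rintro _ ⟨r, rfl⟩
      have h1 := isAwayHom_toSections (R := LocallyRingedSpace.Γ.obj (op X)) r rfl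
      have h2 := h' r _ (X.toΓSpecMapBasicOpen_eq r)
      refine h1.bijective h2 (X.toΓSpec.c.app (op (PrimeSpectrum.basicOpen r))).hom fun x => ?_
      exact ConcreteCategory.congr_hom (X.toΓSpecSheafedSpace_app_spec r) x
    exact (inferInstance : IsIso ((sheafToPresheaf _ _).map α))
  have h1 : IsIso X.toΓSpec.toShHom.hom :=
    @PresheafedSpace.isIso_of_components _ _ _ _ X.toΓSpec.toShHom.hom hbase hc
  have h2 : IsIso X.toΓSpec.toShHom :=
    @isIso_of_reflects_iso _ _ _ _ _ _ X.toΓSpec.toShHom SheafedSpace.forgetToPresheafedSpace h1 _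
  exact @isIso_of_reflects_iso _ _ _ _ _ _ X.toΓSpec LocallyRingedSpace.forgetToSheafedSpace h2 _

end

section

variable {D S : Type u} [AddCommGroup D] [DecidableEq D] [CommRing S]
variable (𝒜 : D → AddSubgroup S) [GradedRing 𝒜]

/-! ### The charts -/

/-- The open subspace of `Q(S)` defined by a homogeneous element. -/
def chartSpace {f : S} (hf : SetLike.IsHomogeneousElem 𝒜 f) : LocallyRingedSpace.{u} :=
  (quot 𝒜).restrict (chartOpen 𝒜 hf).isOpenEmbedding

/-- The inclusion of a chart into `Q(S)`. -/
def chartIncl {f : S} (hf : SetLike.IsHomogeneousElem 𝒜 f) : chartSpace 𝒜 hf ⟶ quot 𝒜 :=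
  (quot 𝒜).ofRestrict (chartOpen 𝒜 hf).isOpenEmbedding

instance {f : S} (hf : SetLike.IsHomogeneousElem 𝒜 f) :
    LocallyRingedSpace.IsOpenImmersion (chartIncl 𝒜 hf) :=
  inferInstanceAs (LocallyRingedSpace.IsOpenImmersion
    ((quot 𝒜).ofRestrict (chartOpen 𝒜 hf).isOpenEmbedding))

theorem range_chartIncl {f : S} (hf : SetLike.IsHomogeneousElem 𝒜 f) :
    Set.range (chartIncl 𝒜 hf).base = chartSet 𝒜 f :=
  Subtype.range_coe

/-- The image in `Q(S)` of an open subset of a chart. -/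
abbrev chartImage {f : S} (hf : SetLike.IsHomogeneousElem 𝒜 f)
    (V : Opens (chartSpace 𝒜 hf).toTopCat) : Opens (quot 𝒜).toTopCat :=
  (chartOpen 𝒜 hf).isOpenEmbedding.functor.obj V

theorem chartImage_top {f : S} (hf : SetLike.IsHomogeneousElem 𝒜 f) :
    chartImage 𝒜 hf ⊤ = chartOpen 𝒜 hf :=
  Opens.ext (Set.image_univ.trans Subtype.range_coe)

/-- Global sections of a chart live over `chartImage 𝒜 hf ⊤`, which is not `chartOpen 𝒜 hf` by
definition. Describing `ψ` by the cross-multiplied relation $x f^k=a$ makes sense over any open set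
equal to the chart. -/
theorem exists_chartSections_of_eq {f : S} (hf : SetLike.IsHomogeneousElem 𝒜 f)
    {U : Opens (quot 𝒜).toTopCat} (hU : U = chartOpen 𝒜 hf) :
    ∃ ψ : HomogeneousLocalization.Away 𝒜 f →+* (quot 𝒜).presheaf.obj (op U),
      Function.Bijective ψ ∧ ∀ x k a, algebraMap _ (Localization.Away f) x *
          algebraMap S (Localization.Away f) (f ^ k) = algebraMap S (Localization.Away f) a →
        quotSections 𝒜 U (ψ x) * toSections (CommRingCat.of S) (quotPre 𝒜 U) (f ^ k) =
          toSections (CommRingCat.of S) (quotPre 𝒜 U) a := by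
  subst hU
  obtain ⟨ψ, hψ, h⟩ := exists_chartSections 𝒜 hf
  refine ⟨ψ, hψ, fun x k a hx => ?_⟩
  rw [h, ← awaySections_algebraMap, ← awaySections_algebraMap, ← map_mul, hx]

theorem chartImage_basicOpen {f : S} (hf : SetLike.IsHomogeneousElem 𝒜 f)
    (r : LocallyRingedSpace.Γ.obj (op (chartSpace 𝒜 hf))) :
    chartImage 𝒜 hf ((chartSpace 𝒜 hf).toRingedSpace.basicOpen r) =
      (quot 𝒜).toRingedSpace.basicOpen
        (show (quot 𝒜).presheaf.obj (op (chartImage 𝒜 hf ⊤)) from r) := by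
  have h1 := LocallyRingedSpace.preimage_basicOpen (chartIncl 𝒜 hf)
    (U := chartImage 𝒜 hf ⊤) r
  have htop : (Opens.map (chartIncl 𝒜 hf).base).obj (chartImage 𝒜 hf ⊤) = ⊤ :=
    (chartOpen 𝒜 hf).isOpenEmbedding.functor_obj_injective
      (Opens.ext (Set.image_preimage_eq_of_subset (Set.image_subset_range _ _)))
  have h2 : (chartSpace 𝒜 hf).toRingedSpace.basicOpen
      ((chartIncl 𝒜 hf).c.app (op (chartImage 𝒜 hf ⊤)) r) =
        (chartSpace 𝒜 hf).toRingedSpace.basicOpen r := by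
    have h3 := (chartSpace 𝒜 hf).toRingedSpace.basicOpen_res
      (homOfLE (le_top : (Opens.map (chartIncl 𝒜 hf).base).obj (chartImage 𝒜 hf ⊤) ≤ ⊤)).op r
    refine Eq.trans h3 ?_
    rw [htop, top_inf_eq]
    rfl
  rw [← h2, ← h1]
  refine Opens.ext ?_
  exact Set.image_preimage_eq_of_subset (f := (Subtype.val : chartSet 𝒜 f → _))
    (subset_trans ((quot 𝒜).toRingedSpace.basicOpen_le _) (Set.image_subset_range _ _))

/-- The canonical morphism from `Spec S_f` to the chart. -/
theorem exists_toChartSpace {f : S} (hf : SetLike.IsHomogeneousElem 𝒜 f) :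
    ∃ η : (Spec (CommRingCat.of (Localization.Away f))).toLocallyRingedSpace ⟶ chartSpace 𝒜 hf,
      η ≫ chartIncl 𝒜 hf =
        (Spec.map (CommRingCat.ofHom (algebraMap S (Localization.Away f)))).toLRSHom ≫
          quotMap 𝒜 := by
  refine ⟨LocallyRingedSpace.IsOpenImmersion.lift (chartIncl 𝒜 hf) _ ?_,
    LocallyRingedSpace.IsOpenImmersion.lift_fac _ _ _⟩
  rw [range_chartIncl]
  rintro _ ⟨P, rfl⟩
  exact (quotMap_mem_chartSet_iff 𝒜 hf _).2 (notMem_comap f P)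

/-- By the adjunction between global sections and `Spec`, a morphism to an affine scheme may be
identified on global sections. -/
theorem comp_toΓSpec_eq {X : LocallyRingedSpace.{u}} {A B : CommRingCat.{u}}
    (η : Spec.locallyRingedSpaceObj B ⟶ X) (ψ : A ⟶ LocallyRingedSpace.Γ.obj (op X)) (g : A ⟶ B)
    (h : ψ ≫ LocallyRingedSpace.Γ.map η.op = g ≫ toSpecΓ B) :
    η ≫ X.toΓSpec ≫ Spec.locallyRingedSpaceMap ψ = Spec.locallyRingedSpaceMap g := by
  have h1 : η ≫ X.toΓSpec = (Spec.locallyRingedSpaceObj B).toΓSpec ≫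
    Spec.locallyRingedSpaceMap (LocallyRingedSpace.Γ.map η.op) := identityToΓSpec.naturality η
  have h2 : (Spec.locallyRingedSpaceObj B).toΓSpec ≫ Spec.locallyRingedSpaceMap (toSpecΓ B) = 𝟙 _ :=
    ΓSpec.right_triangle B
  have h3 := Spec.locallyRingedSpaceMap_comp ψ (LocallyRingedSpace.Γ.map η.op)
  have h4 := Spec.locallyRingedSpaceMap_comp g (toSpecΓ B)
  rw [h] at h3
  calc η ≫ X.toΓSpec ≫ Spec.locallyRingedSpaceMap ψ
      = (Spec.locallyRingedSpaceObj B).toΓSpec ≫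
        Spec.locallyRingedSpaceMap (LocallyRingedSpace.Γ.map η.op) ≫
          Spec.locallyRingedSpaceMap ψ := h1 =≫ Spec.locallyRingedSpaceMap ψ
    _ = (Spec.locallyRingedSpaceObj B).toΓSpec ≫ Spec.locallyRingedSpaceMap (toSpecΓ B) ≫
          Spec.locallyRingedSpaceMap g := congrArg _ (h3.symm.trans h4)
    _ = Spec.locallyRingedSpaceMap g := h2 =≫ Spec.locallyRingedSpaceMap g

/-- Pull-back of sections from a chart to `Spec S_f`. -/
theorem exists_pullback_chart {f : S} (hf : SetLike.IsHomogeneousElem 𝒜 f)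
    (η : (Spec (CommRingCat.of (Localization.Away f))).toLocallyRingedSpace ⟶ chartSpace 𝒜 hf)
    (hη : η ≫ chartIncl 𝒜 hf =
      (Spec.map (CommRingCat.ofHom (algebraMap S (Localization.Away f)))).toLRSHom ≫
        quotMap 𝒜) :
    ∃ T : Γ(Spec (CommRingCat.of S), quotPre 𝒜 (chartImage 𝒜 hf ⊤)) →+*
        Γ(Spec (CommRingCat.of (Localization.Away f)), ⊤),
      (∀ t, η.c.app (op ⊤) t = T (quotSections 𝒜 (chartImage 𝒜 hf ⊤) t)) ∧
      ∀ s : S, T (toSections (CommRingCat.of S) _ s) =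
        toSpecΓ (CommRingCat.of (Localization.Away f)) (algebraMap S (Localization.Away f) s) := by
  let i := Spec.map (CommRingCat.ofHom (algebraMap S (Localization.Away f)))
  have hle : ⊤ ≤ i ⁻¹ᵁ (quotPre 𝒜 (chartImage 𝒜 hf ⊤)) := by
    intro P _
    change (quotMap 𝒜).base _ ∈ chartImage 𝒜 hf ⊤
    rw [chartImage_top]
    exact (quotMap_mem_chartSet_iff 𝒜 hf _).2 (notMem_comap f P)
  refine ⟨(i.app _ ≫ (Spec (CommRingCat.of (Localization.Away f))).presheaf.map
    (homOfLE hle).op).hom, fun t => ?_, fun s => ?_⟩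
  · have h := PresheafedSpace.congr_app (congrArg (fun g => g.toShHom.hom) hη)
      (op (chartImage 𝒜 hf ⊤))
    have hle' : ⊤ ≤ (Opens.map η.base).obj
        ((Opens.map (chartIncl 𝒜 hf).base).obj (chartImage 𝒜 hf ⊤)) := by
      intro P _
      exact ⟨η.base P, trivial, rfl⟩
    have h' := h =≫ (Spec (CommRingCat.of (Localization.Away f))).presheaf.map
      (homOfLE hle').op
    have h2 := ConcreteCategory.congr_hom h' t
    have hnat := η.c.naturality (homOfLE (le_top : (Opens.map (chartIncl 𝒜 hf).base).obj
      (chartImage 𝒜 hf ⊤) ≤ ⊤)).op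
    have hnat' := hnat =≫ (Spec (CommRingCat.of (Localization.Away f))).presheaf.map
      (homOfLE hle').op
    have h3 := ConcreteCategory.congr_hom hnat' t
    have hid : ∀ (U : (Spec (CommRingCat.of (Localization.Away f))).Opens) (h1 : U ≤ ⊤) (h2 : ⊤ ≤ U)
        (y : Γ(Spec (CommRingCat.of (Localization.Away f)), ⊤)),
        (Spec (CommRingCat.of (Localization.Away f))).presheaf.map (homOfLE h2).op
          ((Spec (CommRingCat.of (Localization.Away f))).presheaf.map (homOfLE h1).op y) = y := by
      intro U h1 h2 y
      change (((Spec (CommRingCat.of (Localization.Away f))).presheaf.map (homOfLE h1).op) ≫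
        (Spec (CommRingCat.of (Localization.Away f))).presheaf.map (homOfLE h2).op) y = y
      rw [← Functor.map_comp]
      exact ConcreteCategory.congr_hom ((Spec (CommRingCat.of (Localization.Away f))).presheaf.map_id
        (op ⊤)) y
    refine (hid _ le_top hle' _).symm.trans (h3.symm.trans ?_)
    refine Eq.trans h2 ?_
    have hres : ∀ (U : (Spec (CommRingCat.of (Localization.Away f))).Opens)
        (p : op (i ⁻¹ᵁ (quotPre 𝒜 (chartImage 𝒜 hf ⊤))) ⟶ op U) (q : op U ⟶ op ⊤) (y),
        (Spec (CommRingCat.of (Localization.Away f))).presheaf.map q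
          ((Spec (CommRingCat.of (Localization.Away f))).presheaf.map p y) =
        (Spec (CommRingCat.of (Localization.Away f))).presheaf.map (homOfLE hle).op y :=
      fun U p q y => (ConcreteCategory.congr_hom
        ((Spec (CommRingCat.of (Localization.Away f))).presheaf.map_comp p q) y).symm
    exact hres _ _ (homOfLE hle').op (i.app _ (quotSections 𝒜 (chartImage 𝒜 hf ⊤) t))
  · change (Spec (CommRingCat.of (Localization.Away f))).presheaf.map (homOfLE hle).op
      (i.app _ (toSections (CommRingCat.of S) _ s)) = _
    rw [app_toSections]
    exact toSections_res _ _ _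

/-- The chart defined by a relevant element `f` is canonically isomorphic to `Spec S_(f)`. -/
theorem exists_chartIso {f : S} (hf : IsRelevant 𝒜 f) :
    ∃ φ : chartSpace 𝒜 hf.1 ⟶
        (Spec (CommRingCat.of (HomogeneousLocalization.Away 𝒜 f))).toLocallyRingedSpace,
      IsIso φ ∧ ∀ η : (Spec (CommRingCat.of (Localization.Away f))).toLocallyRingedSpace ⟶
          chartSpace 𝒜 hf.1,
        η ≫ chartIncl 𝒜 hf.1 =
          (Spec.map (CommRingCat.ofHom (algebraMap S (Localization.Away f)))).toLRSHom ≫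
            quotMap 𝒜 →
        η ≫ φ = (Spec.map (CommRingCat.ofHom (algebraMap
          (HomogeneousLocalization.Away 𝒜 f) (Localization.Away f)))).toLRSHom := by
  obtain ⟨ψ, hψ, hψ'⟩ := exists_chartSections_of_eq 𝒜 hf.1 (chartImage_top 𝒜 hf.1)
  let ψ' : CommRingCat.of (HomogeneousLocalization.Away 𝒜 f) ⟶
    LocallyRingedSpace.Γ.obj (op (chartSpace 𝒜 hf.1)) := CommRingCat.ofHom ψ
  have hψiso : IsIso ψ' := (ConcreteCategory.isIso_iff_bijective _).2 hψ
  let m := Spec.locallyRingedSpaceMap ψ'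
  have hm : IsIso m := (inferInstance : IsIso (Spec.toLocallyRingedSpace.map ψ'.op))
  have hη : ∀ η : (Spec (CommRingCat.of (Localization.Away f))).toLocallyRingedSpace ⟶
          chartSpace 𝒜 hf.1,
        η ≫ chartIncl 𝒜 hf.1 =
          (Spec.map (CommRingCat.ofHom (algebraMap S (Localization.Away f)))).toLRSHom ≫
            quotMap 𝒜 →
        η ≫ (chartSpace 𝒜 hf.1).toΓSpec ≫ m = (Spec.map (CommRingCat.ofHom (algebraMap
          (HomogeneousLocalization.Away 𝒜 f) (Localization.Away f)))).toLRSHom := by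
    intro η hη
    refine comp_toΓSpec_eq η ψ' _ (CommRingCat.hom_ext (RingHom.ext fun x => ?_))
    obtain ⟨T, hT, hT'⟩ := exists_pullback_chart 𝒜 hf.1 η hη
    obtain ⟨e, he⟩ := id hf.1
    obtain ⟨k, a, ha, hxa⟩ := HomogeneousLocalization.Away.mk_surjective 𝒜 he x
    have hspec : algebraMap _ (Localization.Away f) x *
        algebraMap S (Localization.Away f) (f ^ k) = algebraMap S (Localization.Away f) a := by
      rw [← hxa]
      change Localization.mk a (⟨f ^ k, k, rfl⟩ : Submonoid.powers f) * _ = _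
      rw [Localization.mk_eq_mk']
      exact IsLocalization.mk'_spec _ a (⟨f ^ k, k, rfl⟩ : Submonoid.powers f)
    have hu : IsUnit ((toSpecΓ (CommRingCat.of (Localization.Away f))).hom
        (algebraMap S (Localization.Away f) (f ^ k))) := by
      rw [map_pow]
      exact ((IsLocalization.Away.algebraMap_isUnit f).pow k).map _
    -- Both sides are compared after multiplication by the unit $f^k$, where only images of elements
    -- of $S$ remain.
    refine hu.mul_left_injective ?_
    change η.c.app (op ⊤) (ψ x) * _ = toSpecΓ _ (algebraMap _ (Localization.Away f) x) * _
    refine Eq.trans ?_ (map_mul (toSpecΓ (CommRingCat.of (Localization.Away f))).hom _ _)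
    rw [hspec]
    refine Eq.trans ?_ (hT' a)
    rw [← hψ' x k a hspec, map_mul]
    exact congrArg₂ _ (hT _) (hT' _).symm
  obtain ⟨η, hη₀⟩ := exists_toChartSpace 𝒜 hf.1
  have hbase : IsHomeomorph ((chartSpace 𝒜 hf.1).toΓSpec ≫ m).base := by
    have hcomp : ∀ P, ((chartSpace 𝒜 hf.1).toΓSpec ≫ m).base (η.base P) =
        PrimeSpectrum.comap (algebraMap (HomogeneousLocalization.Away 𝒜 f)
          (Localization.Away f)) P := fun P => congrArg (fun g => g.base P) (hη η hη₀)
    -- Precomposed with `η` the map becomes the quotient map from $\mathrm{Spec}\,S_f$ to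
    -- $\mathrm{Spec}\,S_{(f)}$, so it is itself a quotient map.
    have hq : Topology.IsQuotientMap ((chartSpace 𝒜 hf.1).toΓSpec ≫ m).base := by
      refine Topology.IsQuotientMap.of_comp (f := η.base) η.base.hom.continuous
        ((chartSpace 𝒜 hf.1).toΓSpec ≫ m).base.hom.continuous ?_
      have : ((chartSpace 𝒜 hf.1).toΓSpec ≫ m).base ∘ η.base = PrimeSpectrum.comap
        (algebraMap (HomogeneousLocalization.Away 𝒜 f) (Localization.Away f)) := funext hcomp
      rw [this]
      exact hf.isQuotientMap_comap
    have hinc : ∀ P, (chartIncl 𝒜 hf.1).base (η.base P) = (quotMap 𝒜).base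
        (PrimeSpectrum.comap (algebraMap S (Localization.Away f)) P) :=
      fun P => congrArg (fun g => g.base P) hη₀
    have hincinj : Function.Injective (chartIncl 𝒜 hf.1).base := Subtype.val_injective
    have hsurj : Function.Surjective η.base := by
      rintro ⟨_, P, hP, rfl⟩
      obtain ⟨P', rfl⟩ := exists_comap_away P hP
      exact ⟨P', hincinj (hinc P')⟩
    -- Equal images in $\mathrm{Spec}\,S_{(f)}$ force equal homogeneous elements by relevance, and
    -- such points are already identified in $Q(S)$.
    have hinj : Function.Injective ((chartSpace 𝒜 hf.1).toΓSpec ≫ m).base := by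
      intro x y hxy
      obtain ⟨P, rfl⟩ := hsurj x
      obtain ⟨P', rfl⟩ := hsurj y
      rw [hcomp, hcomp] at hxy
      refine hincinj ?_
      rw [hinc, hinc]
      have hxy' : PrimeSpectrum.comap (algebraMap (HomogeneousLocalization.Away 𝒜 f)
        (Localization.Away f)) P = PrimeSpectrum.comap (algebraMap
          (HomogeneousLocalization.Away 𝒜 f) (Localization.Away f)) P' := hxy
      exact quotMap_eq_of_homogeneousCore_eq (DSpec.ext (le_antisymm
        (hf.homogeneousCore_le hxy'.le) (hf.homogeneousCore_le hxy'.ge)))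
    exact isHomeomorph_iff_isQuotientMap_injective.2 ⟨hq, hinj⟩
  have : IsIso (chartSpace 𝒜 hf.1).toΓSpec := by
    refine isIso_toΓSpec _ ?_ ?_
    · have h1 : IsIso ((chartSpace 𝒜 hf.1).toΓSpec.base ≫ m.base) :=
        (TopCat.isIso_iff_isHomeomorph _).2 hbase
      have h2 : IsIso m.base := (inferInstance : IsIso (LocallyRingedSpace.forgetToTop.map m))
      exact (TopCat.isIso_iff_isHomeomorph _).1 (IsIso.of_isIso_comp_right _ m.base)
    · rintro r V rfl
      refine isAwayHom_quot_map 𝒜 (U := chartImage 𝒜 hf.1 ⊤)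
        (V := chartImage 𝒜 hf.1 ((chartSpace 𝒜 hf.1).toRingedSpace.basicOpen r))
        ((chartOpen 𝒜 hf.1).isOpenEmbedding.functor.monotone le_top) ?_ r
        (chartImage_basicOpen 𝒜 hf.1 r)
      rw [chartImage_top]
      exact isAffineOpen_quotPre_chartOpen 𝒜 hf.1
  exact ⟨(chartSpace 𝒜 hf.1).toΓSpec ≫ m, @IsIso.comp_isIso _ _ _ _ _ _ _ this hm, hη⟩

end

section

variable {D S : Type u} [AddCommGroup D] [DecidableEq D] [CommRing S]
variable (𝒜 : D → AddSubgroup S) [GradedRing 𝒜]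

/-! ### Canonical charts of $\mathrm{Proj}^D(S)$ -/

theorem isOpenImmersion_lift {X Y Z : LocallyRingedSpace.{u}} (f : X ⟶ Z) (g : Y ⟶ Z)
    [LocallyRingedSpace.IsOpenImmersion f] [LocallyRingedSpace.IsOpenImmersion g]
    (h : Set.range g.base ⊆ Set.range f.base) :
    LocallyRingedSpace.IsOpenImmersion (LocallyRingedSpace.IsOpenImmersion.lift f g h) := by
  have := LocallyRingedSpace.IsOpenImmersion.pullback_snd_isIso_of_range_subset f g h
  unfold LocallyRingedSpace.IsOpenImmersion.lift
  infer_instance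

instance : LocallyRingedSpace.IsOpenImmersion (multiProjIncl 𝒜) :=
  inferInstanceAs (LocallyRingedSpace.IsOpenImmersion
    ((quot 𝒜).ofRestrict (projOpen 𝒜).isOpenEmbedding))

theorem range_multiProjIncl : Set.range (multiProjIncl 𝒜).base = (projOpen 𝒜).carrier :=
  Subtype.range_coe

theorem chartSet_subset_projOpen {f : S} (hf : IsRelevant 𝒜 f) :
    chartSet 𝒜 f ⊆ (projOpen 𝒜).carrier :=
  Set.subset_biUnion_of_mem (u := chartSet 𝒜) (show f ∈ {f | IsRelevant 𝒜 f} from hf)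

theorem exists_chart {f : S} (hf : IsRelevant 𝒜 f) :
    ∃ j : (Spec (CommRingCat.of (HomogeneousLocalization.Away 𝒜 f))).toLocallyRingedSpace ⟶
      multiProj 𝒜, IsChart 𝒜 f j ∧ Set.range (j ≫ multiProjIncl 𝒜).base = chartSet 𝒜 f := by
  obtain ⟨φ, hφ, h⟩ := exists_chartIso 𝒜 hf
  obtain ⟨η, hη⟩ := exists_toChartSpace 𝒜 hf.1
  have hrange : Set.range (inv φ ≫ chartIncl 𝒜 hf.1).base = chartSet 𝒜 f := by
    have hsurj : Function.Surjective (inv φ).base :=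
      (TopCat.isIso_iff_isHomeomorph _).1
        (inferInstance : IsIso (LocallyRingedSpace.forgetToTop.map (inv φ))) |>.surjective
    rw [← range_chartIncl 𝒜 hf.1]
    exact hsurj.range_comp (chartIncl 𝒜 hf.1).base
  have hle : Set.range (inv φ ≫ chartIncl 𝒜 hf.1).base ⊆ Set.range (multiProjIncl 𝒜).base := by
    rw [hrange, range_multiProjIncl]
    exact chartSet_subset_projOpen 𝒜 hf
  have hfac := LocallyRingedSpace.IsOpenImmersion.lift_fac (multiProjIncl 𝒜)
    (inv φ ≫ chartIncl 𝒜 hf.1) hle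
  refine ⟨LocallyRingedSpace.IsOpenImmersion.lift (multiProjIncl 𝒜) (inv φ ≫ chartIncl 𝒜 hf.1) hle,
    ⟨isOpenImmersion_lift _ _ _, ?_⟩, ?_⟩
  · rw [hfac, ← hη, ← h η hη, Category.assoc, IsIso.hom_inv_id_assoc]
  · rw [hfac, hrange]

/-- The canonical chart `Spec S_(f) ⟶ Proj^D(S)`. -/
def chart {f : S} (hf : IsRelevant 𝒜 f) :
    (Spec (CommRingCat.of (HomogeneousLocalization.Away 𝒜 f))).toLocallyRingedSpace ⟶
      multiProj 𝒜 :=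
  (exists_chart 𝒜 hf).choose

theorem isChart_chart {f : S} (hf : IsRelevant 𝒜 f) : IsChart 𝒜 f (chart 𝒜 hf) :=
  (exists_chart 𝒜 hf).choose_spec.1

instance {f : S} (hf : IsRelevant 𝒜 f) : LocallyRingedSpace.IsOpenImmersion (chart 𝒜 hf) :=
  (isChart_chart 𝒜 hf).isOpenImmersion

theorem range_chart_comp {f : S} (hf : IsRelevant 𝒜 f) :
    Set.range (chart 𝒜 hf ≫ multiProjIncl 𝒜).base = chartSet 𝒜 f :=
  (exists_chart 𝒜 hf).choose_spec.2

theorem mem_range_chart_iff {f : S} (hf : IsRelevant 𝒜 f) (x : (multiProj 𝒜).toTopCat) :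
    x ∈ Set.range (chart 𝒜 hf).base ↔ (multiProjIncl 𝒜).base x ∈ chartSet 𝒜 f := by
  rw [← range_chart_comp 𝒜 hf]
  constructor
  · rintro ⟨q, rfl⟩
    exact ⟨q, rfl⟩
  · rintro ⟨q, hq⟩
    exact ⟨q, Subtype.val_injective hq⟩

theorem chart_comp_apply {f : S} (hf : IsRelevant 𝒜 f)
    (P : PrimeSpectrum (Localization.Away f)) :
    (chart 𝒜 hf ≫ multiProjIncl 𝒜).base (PrimeSpectrum.comap (algebraMap
        (HomogeneousLocalization.Away 𝒜 f) (Localization.Away f)) P) =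
      (quotMap 𝒜).base (PrimeSpectrum.comap (algebraMap S (Localization.Away f)) P) :=
  congrArg (fun g => g.base P) (isChart_chart 𝒜 hf).fac

/-! ### The map `θ` on the charts -/

variable {𝒜}

/-- Powers of $f$ are nonzerodivisors modulo a $D$-prime ideal not containing $f$, so denominators
do not matter. -/
theorem mk_mem_psiIdeal_iff {f : S} {e : D} (he : f ∈ 𝒜 e) {p : DSpec 𝒜} (hp : f ∉ p.asIdeal)
    (k : ℕ) (a : S) (ha : a ∈ 𝒜 (k • e)) :
    HomogeneousLocalization.Away.mk 𝒜 he k a ha ∈ psiIdeal 𝒜 f p ↔ a ∈ p.asIdeal := by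
  change Localization.mk a (⟨f ^ k, k, rfl⟩ : Submonoid.powers f) ∈
    p.asIdeal.map (algebraMap S (Localization.Away f)) ↔ _
  rw [Localization.mk_eq_mk', IsLocalization.mk'_mem_iff,
    IsLocalization.algebraMap_mem_map_algebraMap_iff (Submonoid.powers f)]
  constructor
  · rintro ⟨_, ⟨m, rfl⟩, hm⟩
    exact p.mem_of_mul_mem ⟨_, SetLike.pow_mem_graded m he⟩
      (p.notMem_of_dvd_pow ⟨e, he⟩ hp dvd_rfl) hm
  · intro h
    exact ⟨1, one_mem _, by simpa using h⟩

theorem psiIdeal_homogeneousCore {f : S} (hf : SetLike.IsHomogeneousElem 𝒜 f)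
    (P : PrimeSpectrum (Localization.Away f)) :
    psiIdeal 𝒜 f (homogeneousCore 𝒜 (PrimeSpectrum.comap (algebraMap S (Localization.Away f)) P)) =
      (PrimeSpectrum.comap (algebraMap (HomogeneousLocalization.Away 𝒜 f) (Localization.Away f))
        P).asIdeal := by
  obtain ⟨e, he⟩ := id hf
  ext x
  obtain ⟨k, a, ha, rfl⟩ := HomogeneousLocalization.Away.mk_surjective 𝒜 he x
  rw [mk_mem_comap_iff 𝒜 he P k a ha, mk_mem_psiIdeal_iff he, mem_homogeneousCore 𝒜 ⟨_, ha⟩]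
  exact fun h => notMem_comap f P ((mem_homogeneousCore 𝒜 hf).1 h)

theorem mem_dPlus_of_isRelevant {f : S} (hf : IsRelevant 𝒜 f) {p : DSpec 𝒜} :
    p ∈ dPlus 𝒜 f ↔ f ∉ p.asIdeal :=
  ⟨fun h => h.2, fun h => ⟨fun h' => h (h' (Ideal.subset_span hf)), h⟩⟩

/-- One equivalence encodes the bijection onto $D_+(f)$ and its inverse. Since
$\mathrm{Spec}\,S_f\to\mathrm{Spec}\,S_{(f)}$ is surjective, it suffices to check it on points
induced by a prime of $S_f$. -/
theorem theta_chart_eq_iff {f : S} (hf : IsRelevant 𝒜 f)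
    (q : PrimeSpectrum (HomogeneousLocalization.Away 𝒜 f)) (p : DSpec 𝒜) :
    theta 𝒜 ((chart 𝒜 hf ≫ multiProjIncl 𝒜).base q) = p ↔
      p ∈ dPlus 𝒜 f ∧ q.asIdeal = psiIdeal 𝒜 f p := by
  have key : ∀ P : PrimeSpectrum (Localization.Away f),
      theta 𝒜 ((chart 𝒜 hf ≫ multiProjIncl 𝒜).base (PrimeSpectrum.comap (algebraMap
        (HomogeneousLocalization.Away 𝒜 f) (Localization.Away f)) P)) =
      homogeneousCore 𝒜 (PrimeSpectrum.comap (algebraMap S (Localization.Away f)) P) := fun P =>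
    (congrArg (theta 𝒜) (chart_comp_apply 𝒜 hf P)).trans (theta_quotMap 𝒜 _)
  constructor
  · rintro rfl
    obtain ⟨P, rfl⟩ := comap_degreeZero_surjective hf.1 q
    rw [key, psiIdeal_homogeneousCore hf.1]
    exact ⟨(mem_dPlus_of_isRelevant hf).2 fun h =>
      notMem_comap f P ((mem_homogeneousCore 𝒜 hf.1).1 h), rfl⟩
  · rintro ⟨hp, hq⟩
    obtain ⟨P, rfl⟩ := exists_homogeneousCore_eq p
    obtain ⟨P, rfl⟩ := exists_comap_away P fun h => hp.2 ((mem_homogeneousCore 𝒜 hf.1).2 h)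
    rw [psiIdeal_homogeneousCore hf.1] at hq
    rw [PrimeSpectrum.ext hq]
    exact key P

end

section

variable {D S : Type u} [AddCommGroup D] [DecidableEq D] [CommRing S]
variable (𝒜 : D → AddSubgroup S) [GradedRing 𝒜]

/-! ### The isomorphism `θ` -/

theorem DSpec.mul_notMem {p : DSpec 𝒜} {f g : S} (hf : SetLike.IsHomogeneousElem 𝒜 f)
    (hg : SetLike.IsHomogeneousElem 𝒜 g) :
    f * g ∉ p.asIdeal ↔ f ∉ p.asIdeal ∧ g ∉ p.asIdeal := by
  refine ⟨fun h => ⟨fun h' => h (p.asIdeal.mul_mem_right _ h'),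
    fun h' => h (p.asIdeal.mul_mem_left _ h')⟩, fun h h' => ?_⟩
  exact (p.mem_or_mem f g hf hg h').elim h.1 h.2

theorem mem_projOpen_iff (z : (quot 𝒜).toTopCat) : z ∈ projOpen 𝒜 ↔ theta 𝒜 z ∈ projD 𝒜 := by
  have h1 : z ∈ projOpen 𝒜 ↔ ∃ f, IsRelevant 𝒜 f ∧ z ∈ chartSet 𝒜 f := by
    refine Set.mem_iUnion₂.trans ?_
    simp
  have h2 : theta 𝒜 z ∈ projD 𝒜 ↔ ∃ f, IsRelevant 𝒜 f ∧ f ∉ (theta 𝒜 z).asIdeal := by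
    change ¬ Ideal.span _ ≤ _ ↔ _
    rw [Ideal.span_le, Set.not_subset]
    rfl
  rw [h1, h2]
  refine exists_congr fun f => and_congr_right fun hf => ?_
  rw [chartSet_eq 𝒜 hf.1]
  rfl

/-- The restriction of `θ` to `Proj^D(S)`. -/
def thetaProj : (multiProj 𝒜).toSheafedSpace ⟶ dSpecRinged 𝒜 :=
  (multiProjIncl 𝒜).toShHom ≫ thetaRinged 𝒜

theorem isOpen_image_theta (U : Opens (multiProj 𝒜).toTopCat) :
    IsOpen ((fun x => theta 𝒜 ((multiProjIncl 𝒜).base x)) '' (U : Set (multiProj 𝒜).toTopCat)) := by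
  refine isOpen_iff_forall_mem_open.2 ?_
  rintro _ ⟨x, hx, rfl⟩
  obtain ⟨f, hf, hxf⟩ := Set.mem_iUnion₂.1 (show (multiProjIncl 𝒜).base x ∈ projOpen 𝒜 from x.2)
  have hf : IsRelevant 𝒜 f := hf
  obtain ⟨q, rfl⟩ := (mem_range_chart_iff 𝒜 hf x).2 hxf
  have hV : IsOpen ((chart 𝒜 hf).base ⁻¹' (U : Set (multiProj 𝒜).toTopCat)) :=
    U.2.preimage (chart 𝒜 hf).base.hom.continuous
  obtain ⟨_, ⟨h, rfl⟩, hq, hle⟩ :=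
    PrimeSpectrum.isTopologicalBasis_basic_opens.exists_subset_of_mem_open
    (show q ∈ _ from hx) hV
  obtain ⟨e, he⟩ := id hf.1
  obtain ⟨k, a, ha, rfl⟩ := HomogeneousLocalization.Away.mk_surjective 𝒜 he h
  have hq0 := (theta_chart_eq_iff hf q _).1 rfl
  -- The basic open set of $a/f^k$ in the chart corresponds to the $D$-prime ideals containing
  -- neither $f$ nor $a$.
  refine ⟨{p | f * a ∉ p.asIdeal}, ?_, isOpen_notMem 𝒜 (hf.1.mul ⟨_, ha⟩), ?_⟩
  · intro p hp
    obtain ⟨hpf, hpa⟩ := (DSpec.mul_notMem 𝒜 hf.1 ⟨_, ha⟩).1 hp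
    obtain ⟨z, rfl⟩ := theta_surjective p
    have hz : z ∈ chartSet 𝒜 f := by
      rw [chartSet_eq 𝒜 hf.1]
      exact hpf
    rw [← range_chart_comp 𝒜 hf] at hz
    obtain ⟨q', rfl⟩ := hz
    refine ⟨(chart 𝒜 hf).base q', hle ?_, rfl⟩
    intro hmem
    refine hpa ((mk_mem_psiIdeal_iff he hpf k a ha).1 ?_)
    rw [← ((theta_chart_eq_iff hf q' _).1 rfl).2]
    exact hmem
  · refine (DSpec.mul_notMem 𝒜 hf.1 ⟨_, ha⟩).2 ⟨hq0.1.2, fun hmem => hq ?_⟩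
    rw [hq0.2]
    exact (mk_mem_psiIdeal_iff he hq0.1.2 k a ha).2 hmem

theorem isOpenEmbedding_theta :
    Topology.IsOpenEmbedding (thetaProj 𝒜).hom.base := by
  refine Topology.IsOpenEmbedding.of_continuous_injective_isOpenMap ?_ ?_ ?_
  · exact (theta 𝒜).hom.continuous.comp (multiProjIncl 𝒜).base.hom.continuous
  · exact theta_injective.comp Subtype.val_injective
  · exact fun U hU => isOpen_image_theta 𝒜 ⟨U, hU⟩

instance : SheafedSpace.IsOpenImmersion (thetaProj 𝒜) where
  base_open := isOpenEmbedding_theta 𝒜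
  c_iso U := by
    let ι : (multiProj 𝒜).toPresheafedSpace ⟶ (quot 𝒜).toPresheafedSpace :=
      (multiProjIncl 𝒜).toShHom.hom
    have hι : PresheafedSpace.IsOpenImmersion ι :=
      inferInstanceAs (LocallyRingedSpace.IsOpenImmersion (multiProjIncl 𝒜))
    -- Injectivity of `θ` on all of $Q(S)$ keeps the preimage of $\theta(U)$ inside
    -- $\mathrm{Proj}^D(S)$; the direct image sheaf there is the sheaf of $Q(S)$ on $U$.
    have hV : (Opens.map (theta 𝒜)).obj ((isOpenEmbedding_theta 𝒜).functor.obj U) =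
        (PresheafedSpace.IsOpenImmersion.opensFunctor ι).obj U := by
      refine Opens.ext (Set.ext fun z => ?_)
      constructor
      · rintro ⟨x, hx, hxz⟩
        exact ⟨x, hx, theta_injective hxz⟩
      · rintro ⟨x, hx, rfl⟩
        exact ⟨x, hx, rfl⟩
    have h := PresheafedSpace.IsOpenImmersion.c_iso' ι U hV
    have h1 : (thetaProj 𝒜).hom.c.app (op ((isOpenEmbedding_theta 𝒜).functor.obj U)) =
        ι.c.app (op ((Opens.map (theta 𝒜)).obj ((isOpenEmbedding_theta 𝒜).functor.obj U))) :=
      Category.id_comp _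
    rw [← h1] at h
    exact h

instance : SheafedSpace.IsOpenImmersion (projDIncl 𝒜) :=
  PresheafedSpace.IsOpenImmersion.ofRestrict (dSpecRinged 𝒜).toPresheafedSpace
    (Opens.isOpenEmbedding (X := TopCat.of (DSpec 𝒜)) (projD 𝒜))

theorem range_thetaProj : Set.range (thetaProj 𝒜).hom.base = (projD 𝒜).carrier := by
  ext p
  obtain ⟨z, rfl⟩ := theta_surjective p
  refine Iff.trans ?_ (mem_projOpen_iff 𝒜 z)
  constructor
  · rintro ⟨x, hx⟩
    exact theta_injective hx ▸ x.2
  · intro hz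
    exact ⟨⟨z, hz⟩, rfl⟩

/-- Two open immersions into the same ringed space with equal ranges have isomorphic sources. -/
theorem exists_thetaIso : ∃ e : (multiProj 𝒜).toSheafedSpace ≅ projDRinged 𝒜,
    e.hom ≫ projDIncl 𝒜 = (multiProjIncl 𝒜).toShHom ≫ thetaRinged 𝒜 := by
  have hrange : Set.range (thetaProj 𝒜).hom.base = Set.range (projDIncl 𝒜).hom.base := by
    rw [range_thetaProj]
    exact Subtype.range_coe.symm
  let F : (multiProj 𝒜).toPresheafedSpace ⟶ (dSpecRinged 𝒜).toPresheafedSpace := (thetaProj 𝒜).hom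
  let G : (projDRinged 𝒜).toPresheafedSpace ⟶ (dSpecRinged 𝒜).toPresheafedSpace :=
    (projDIncl 𝒜).hom
  have h1 : PresheafedSpace.IsOpenImmersion F :=
    inferInstanceAs (SheafedSpace.IsOpenImmersion (thetaProj 𝒜))
  have h2 : PresheafedSpace.IsOpenImmersion G :=
    inferInstanceAs (SheafedSpace.IsOpenImmersion (projDIncl 𝒜))
  let e₀ := PresheafedSpace.IsOpenImmersion.isoOfRangeEq F G hrange
  have he₀ : e₀.hom ≫ G = F := PresheafedSpace.IsOpenImmersion.lift_fac G F hrange.le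
  let e : SheafedSpace.forgetToPresheafedSpace.obj (multiProj 𝒜).toSheafedSpace ≅
    SheafedSpace.forgetToPresheafedSpace.obj (projDRinged 𝒜) := e₀
  refine ⟨SheafedSpace.forgetToPresheafedSpace.preimageIso e, ?_⟩
  refine SheafedSpace.forgetToPresheafedSpace.map_injective ?_
  rw [Functor.map_comp, Functor.preimageIso_hom, Functor.map_preimage]
  exact he₀

end

section

variable {D S : Type u} [AddCommGroup D] [DecidableEq D] [CommRing S]
variable (𝒜 : D → AddSubgroup S) [GradedRing 𝒜]

/-! ### `Proj^D(S)` as a scheme -/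

/-- The multigraded spectrum as a scheme. -/
def multiProjScheme : Scheme.{u} :=
  LocallyRingedSpace.IsOpenImmersion.scheme (multiProj 𝒜) (by
    intro x
    obtain ⟨f, hf, hxf⟩ := Set.mem_iUnion₂.1 (show (multiProjIncl 𝒜).base x ∈ projOpen 𝒜 from x.2)
    have hf : IsRelevant 𝒜 f := hf
    exact ⟨_, chart 𝒜 hf, (mem_range_chart_iff 𝒜 hf x).2 hxf, (isChart_chart 𝒜 hf).isOpenImmersion⟩)

variable {𝒜}

/-- The chart `Spec S_(f) ⟶ Proj^D(S)` as a morphism of schemes. -/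
def chartHom {f : S} (hf : IsRelevant 𝒜 f) :
    Spec (CommRingCat.of (HomogeneousLocalization.Away 𝒜 f)) ⟶ multiProjScheme 𝒜 :=
  ⟨chart 𝒜 hf⟩

instance {f : S} (hf : IsRelevant 𝒜 f) : IsOpenImmersion (chartHom hf) :=
  (isChart_chart 𝒜 hf).isOpenImmersion

theorem mem_range_chartHom_iff {f : S} (hf : IsRelevant 𝒜 f) (x : multiProjScheme 𝒜) :
    x ∈ Set.range (chartHom hf) ↔ (multiProjIncl 𝒜).base x ∈ chartSet 𝒜 f :=
  mem_range_chart_iff 𝒜 hf x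

theorem exists_mem_range_chartHom (x : multiProjScheme 𝒜) :
    ∃ (f : S) (hf : IsRelevant 𝒜 f), x ∈ Set.range (chartHom hf) := by
  obtain ⟨f, hf, hxf⟩ := Set.mem_iUnion₂.1 (show (multiProjIncl 𝒜).base x ∈ projOpen 𝒜 from x.2)
  exact ⟨f, hf, (mem_range_chartHom_iff hf x).2 hxf⟩

theorem chartSet_inter {f g : S} (hf : SetLike.IsHomogeneousElem 𝒜 f)
    (hg : SetLike.IsHomogeneousElem 𝒜 g) :
    chartSet 𝒜 f ∩ chartSet 𝒜 g = chartSet 𝒜 (f * g) := by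
  rw [chartSet_eq 𝒜 hf, chartSet_eq 𝒜 hg, chartSet_eq 𝒜 (hf.mul hg)]
  exact Set.ext fun z => (DSpec.mul_notMem 𝒜 hf hg).symm

theorem dPlus_inter {f g : S} (hf : SetLike.IsHomogeneousElem 𝒜 f)
    (hg : SetLike.IsHomogeneousElem 𝒜 g) :
    dPlus 𝒜 f ∩ dPlus 𝒜 g = dPlus 𝒜 (f * g) := by
  ext p
  have := DSpec.mul_notMem 𝒜 (p := p) hf hg
  simp only [dPlus, Set.mem_inter_iff, Set.mem_ofPred_eq, this]
  tauto

theorem range_chartHom_inter {f g : S} (hf : IsRelevant 𝒜 f) (hg : IsRelevant 𝒜 g)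
    (hfg : IsRelevant 𝒜 (f * g)) :
    Set.range (chartHom hf) ∩ Set.range (chartHom hg) = Set.range (chartHom hfg) := by
  ext x
  rw [Set.mem_inter_iff, mem_range_chartHom_iff, mem_range_chartHom_iff, mem_range_chartHom_iff,
    ← chartSet_inter hf.1 hg.1]
  rfl

/-- The larger chart being an open immersion, the smaller factors through it by some
$\mathrm{Spec}\,\psi$. The defining squares of both charts determine $\psi$ after composing with the
injection $S_{(h)}\to S_h$. -/
theorem spec_awayMap_comp_chartHom {f g h : S} (hf : IsRelevant 𝒜 f) (hh : IsRelevant 𝒜 h) {e : D}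
    (hg : g ∈ 𝒜 e) (hfg : h = f * g) :
    Spec.map (CommRingCat.ofHom (HomogeneousLocalization.awayMap 𝒜 hg hfg)) ≫ chartHom hf =
      chartHom hh := by
  have hle : Set.range (chartHom hh) ⊆ Set.range (chartHom hf) := by
    intro x hx
    rw [mem_range_chartHom_iff] at hx ⊢
    rw [hfg, ← chartSet_inter hf.1 ⟨e, hg⟩] at hx
    exact hx.1
  obtain ⟨ψ, hψ⟩ := Spec.map_surjective (IsOpenImmersion.lift (chartHom hf) (chartHom hh) hle)
  have hfac : Spec.map ψ ≫ chartHom hf = chartHom hh := by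
    rw [hψ, IsOpenImmersion.lift_fac]
  suffices hψ' : ψ = CommRingCat.ofHom (HomogeneousLocalization.awayMap 𝒜 hg hfg) by
    rw [← hψ', hfac]
  let a : Localization.Away f →+* Localization.Away h := Localization.awayLift (algebraMap S _) _
    (isUnit_of_dvd_unit (map_dvd _ ⟨_, hfg⟩) (IsLocalization.Away.algebraMap_isUnit h))
  let αf : HomogeneousLocalization.Away 𝒜 f →+* Localization.Away f := algebraMap _ _
  let αh : HomogeneousLocalization.Away 𝒜 h →+* Localization.Away h := algebraMap _ _
  have ha : αh.comp (HomogeneousLocalization.awayMap 𝒜 hg hfg) = a.comp αf :=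
    RingHom.ext fun x => HomogeneousLocalization.val_awayMap 𝒜 hg hfg x
  have ha' : a.comp (algebraMap S (Localization.Away f)) = algebraMap S (Localization.Away h) :=
    RingHom.ext fun x => IsLocalization.lift_eq _ x
  have h1 : Spec.map (CommRingCat.ofHom αh) ≫ Spec.map ψ =
      Spec.map (CommRingCat.ofHom a) ≫ Spec.map (CommRingCat.ofHom αf) := by
    refine Scheme.Hom.ext' ?_
    have hψ' : (Spec.map ψ).toLRSHom ≫ chart 𝒜 hf = chart 𝒜 hh :=
      congrArg (fun c : _ ⟶ multiProjScheme 𝒜 => c.toLRSHom) hfac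
    have ha'' : (Spec.map (CommRingCat.ofHom a)).toLRSHom ≫
        (Spec.map (CommRingCat.ofHom (algebraMap S (Localization.Away f)))).toLRSHom =
        (Spec.map (CommRingCat.ofHom (algebraMap S (Localization.Away h)))).toLRSHom := by
      rw [← ha', CommRingCat.ofHom_comp (algebraMap S (Localization.Away f)) a, Spec.map_comp]
      rfl
    -- Charts and the inclusion into $Q(S)$ are monomorphisms, so the comparison can take place in
    -- $Q(S)$, where both sides come from $\mathrm{Spec}\,S$.
    rw [← cancel_mono (chart 𝒜 hf), ← cancel_mono (multiProjIncl 𝒜)]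
    change (((Spec.map (CommRingCat.ofHom αh)).toLRSHom ≫ (Spec.map ψ).toLRSHom) ≫ chart 𝒜 hf) ≫
      multiProjIncl 𝒜 = (((Spec.map (CommRingCat.ofHom a)).toLRSHom ≫
        (Spec.map (CommRingCat.ofHom αf)).toLRSHom) ≫ chart 𝒜 hf) ≫ multiProjIncl 𝒜
    simp only [Category.assoc]
    rw [reassoc_of% hψ', (isChart_chart 𝒜 hh).fac, (isChart_chart 𝒜 hf).fac, reassoc_of% ha'']
  have h2 : ψ ≫ CommRingCat.ofHom αh = CommRingCat.ofHom αf ≫ CommRingCat.ofHom a := by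
    refine Spec.map_injective ?_
    rw [Spec.map_comp, Spec.map_comp, h1]
  refine CommRingCat.hom_ext (RingHom.ext fun x => ?_)
  refine algebraMap_degreeZero_injective 𝒜 h ?_
  exact (ConcreteCategory.congr_hom h2 x).trans (RingHom.congr_fun ha x).symm

/-- A cone lands set-theoretically in the intersection of the ranges, hence lifts through `c`; the
projections and uniqueness follow by cancelling monomorphisms. -/
theorem isPullback_of_range_inter {X Y Z W : Scheme.{u}} {a : W ⟶ X} {b : W ⟶ Y} {f : X ⟶ Z}
    {g : Y ⟶ Z} {c : W ⟶ Z} [IsOpenImmersion f] [IsOpenImmersion g] [IsOpenImmersion c]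
    (ha : a ≫ f = c) (hb : b ≫ g = c) (h : Set.range f ∩ Set.range g = Set.range c) :
    IsPullback a b f g := by
  have hle : ∀ s : PullbackCone f g, Set.range (s.fst ≫ f) ⊆ Set.range c := by
    intro s
    rw [← h]
    refine Set.subset_inter ?_ ?_
    · rintro _ ⟨x, rfl⟩
      exact ⟨s.fst x, rfl⟩
    · rw [s.condition]
      rintro _ ⟨x, rfl⟩
      exact ⟨s.snd x, rfl⟩
  refine ⟨⟨ha.trans hb.symm⟩, ⟨PullbackCone.IsLimit.mk _
    (fun s => IsOpenImmersion.lift c (s.fst ≫ f) (hle s)) (fun s => ?_) (fun s => ?_) ?_⟩⟩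
  · rw [← cancel_mono f, Category.assoc, ha, IsOpenImmersion.lift_fac]
  · rw [← cancel_mono g, Category.assoc, hb, IsOpenImmersion.lift_fac, s.condition]
  · intro s m hm _
    rw [← cancel_mono c, IsOpenImmersion.lift_fac, ← ha, reassoc_of% hm]

end

section

variable {D S : Type u} [AddCommGroup D] [DecidableEq D] [CommRing S]
variable {𝒜 : D → AddSubgroup S} [GradedRing 𝒜]

/-! ### The affine case -/

/-- Every subgroup of a finite group has finite index, so both cases of (a) reduce to $1$ being
relevant. -/
theorem isRelevant_one_of_finite [Finite D] : IsRelevant 𝒜 1 :=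
  ⟨SetLike.isHomogeneousElem_one 𝒜, inferInstance⟩

theorem projD_eq_top (h1 : IsRelevant 𝒜 1) : projD 𝒜 = ⊤ :=
  top_le_iff.1 fun p _ h =>
    p.ne_top ((Ideal.eq_top_iff_one _).2 (h (Ideal.subset_span h1)))

theorem mem_chartSet_one (z : (quot 𝒜).toTopCat) : z ∈ chartSet 𝒜 1 := by
  rw [chartSet_eq 𝒜 (SetLike.isHomogeneousElem_one 𝒜)]
  exact fun h => (theta 𝒜 z).ne_top ((Ideal.eq_top_iff_one _).2 h)

theorem bijective_algebraMap_away_one :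
    Function.Bijective (algebraMap (𝒜 0) (HomogeneousLocalization.Away 𝒜 1)) := by
  have hu : ∀ x : S, algebraMap S (Localization.Away (1 : S)) x = 0 → x = 0 := by
    intro x hx
    obtain ⟨⟨_, n, rfl⟩, h⟩ := (IsLocalization.map_eq_zero_iff (Submonoid.powers (1 : S)) _ x).1 hx
    simpa using h
  constructor
  · rw [injective_iff_map_eq_zero]
    intro x hx
    refine Subtype.ext (hu x ?_)
    exact (congrArg (algebraMap _ (Localization.Away (1 : S))) hx).trans (map_zero _)
  · intro y
    obtain ⟨k, a, ha, rfl⟩ :=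
      HomogeneousLocalization.Away.mk_surjective 𝒜 (SetLike.one_mem_graded 𝒜) y
    refine ⟨⟨a, by simpa using ha⟩, algebraMap_degreeZero_injective 𝒜 1 ?_⟩
    change Localization.mk a _ = Localization.mk a _
    congr 1
    exact Subtype.ext (one_pow k).symm

/-- This identifies $Q(S)\to\mathrm{Spec}\,S_0$ on the single chart for $f=1$, where $S_0\cong
S_{(1)}$. -/
theorem chart_one_comp_quotToSpecZero (h1 : IsRelevant 𝒜 1) :
    chart 𝒜 h1 ≫ multiProjIncl 𝒜 ≫ quotToSpecZero 𝒜 =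
      (Spec.map (CommRingCat.ofHom
        (algebraMap (𝒜 0) (HomogeneousLocalization.Away 𝒜 1)))).toLRSHom := by
  let g : Spec (CommRingCat.of (HomogeneousLocalization.Away 𝒜 1)) ⟶ Spec (CommRingCat.of (𝒜 0)) :=
    ⟨chart 𝒜 h1 ≫ multiProjIncl 𝒜 ≫ quotToSpecZero 𝒜⟩
  obtain ⟨ψ, hψ⟩ := Spec.map_surjective g
  suffices h : ψ = CommRingCat.ofHom (algebraMap (𝒜 0) (HomogeneousLocalization.Away 𝒜 1)) by
    rw [← h, hψ]
  let α : HomogeneousLocalization.Away 𝒜 1 →+* Localization.Away (1 : S) := algebraMap _ _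
  have hπ : quotMap 𝒜 ≫ quotToSpecZero 𝒜 =
    (Spec.map (CommRingCat.ofHom (algebraMap (𝒜 0) S))).toLRSHom := coequalizer.π_desc _ _
  have h2 : Spec.map (CommRingCat.ofHom α) ≫ Spec.map ψ =
      Spec.map (CommRingCat.ofHom (algebraMap S (Localization.Away (1 : S)))) ≫
        Spec.map (CommRingCat.ofHom (algebraMap (𝒜 0) S)) := by
    rw [hψ]
    refine Scheme.Hom.ext' ?_
    change (Spec.map (CommRingCat.ofHom α)).toLRSHom ≫
      chart 𝒜 h1 ≫ multiProjIncl 𝒜 ≫ quotToSpecZero 𝒜 =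
      (Spec.map (CommRingCat.ofHom (algebraMap S (Localization.Away (1 : S))))).toLRSHom ≫
        (Spec.map (CommRingCat.ofHom (algebraMap (𝒜 0) S))).toLRSHom
    have hfac := (isChart_chart 𝒜 h1).fac =≫ quotToSpecZero 𝒜
    simp only [Category.assoc] at hfac
    rw [hfac, hπ]
  have h3 : ψ ≫ CommRingCat.ofHom α = CommRingCat.ofHom (algebraMap (𝒜 0) S) ≫
      CommRingCat.ofHom (algebraMap S (Localization.Away (1 : S))) := by
    refine Spec.map_injective ?_
    rw [Spec.map_comp, Spec.map_comp, h2]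
  refine CommRingCat.hom_ext (RingHom.ext fun x => ?_)
  exact algebraMap_degreeZero_injective 𝒜 1 (ConcreteCategory.congr_hom h3 x)

theorem isIso_of_isOpenImmersion_of_surjective {X Y : LocallyRingedSpace.{u}} (f : X ⟶ Y)
    [LocallyRingedSpace.IsOpenImmersion f] (h : Function.Surjective f.base) : IsIso f := by
  have : Epi f.base := (TopCat.epi_iff_surjective _).2 h
  exact LocallyRingedSpace.IsOpenImmersion.to_iso f

theorem isIso_multiProjIncl (h1 : IsRelevant 𝒜 1) : IsIso (multiProjIncl 𝒜) :=
  isIso_of_isOpenImmersion_of_surjective _ fun z =>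
    ⟨⟨z, chartSet_subset_projOpen 𝒜 h1 (mem_chartSet_one z)⟩, rfl⟩

theorem isIso_chart_one (h1 : IsRelevant 𝒜 1) : IsIso (chart 𝒜 h1) :=
  isIso_of_isOpenImmersion_of_surjective _ fun x =>
    (mem_range_chart_iff 𝒜 h1 x).2 (mem_chartSet_one _)

theorem isIso_multiProjIncl_comp (h1 : IsRelevant 𝒜 1) :
    IsIso (multiProjIncl 𝒜 ≫ quotToSpecZero 𝒜) := by
  have := isIso_chart_one h1
  have h2 : IsIso (CommRingCat.ofHom (algebraMap (𝒜 0) (HomogeneousLocalization.Away 𝒜 1))) :=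
    (ConcreteCategory.isIso_iff_bijective _).2 bijective_algebraMap_away_one
  have h3 : IsIso (Spec.map (CommRingCat.ofHom
      (algebraMap (𝒜 0) (HomogeneousLocalization.Away 𝒜 1)))).toLRSHom :=
    (inferInstance : IsIso (Scheme.forgetToLocallyRingedSpace.map (Spec.map (CommRingCat.ofHom
      (algebraMap (𝒜 0) (HomogeneousLocalization.Away 𝒜 1))))))
  rw [← chart_one_comp_quotToSpecZero h1] at h3
  exact IsIso.of_isIso_comp_left (chart 𝒜 h1) _

theorem isIso_thetaRinged (h1 : IsRelevant 𝒜 1) : IsIso (thetaRinged 𝒜) := by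
  have := isIso_multiProjIncl h1
  have h2 : IsIso (multiProjIncl 𝒜).toShHom :=
    (inferInstance : IsIso (LocallyRingedSpace.forgetToSheafedSpace.map (multiProjIncl 𝒜)))
  have h3 : IsIso (thetaProj 𝒜) := by
    have : Epi (thetaProj 𝒜).hom.base := by
      refine (TopCat.epi_iff_surjective _).2 fun p => ?_
      have hp : p ∈ (projD 𝒜).carrier := by
        rw [projD_eq_top h1]
        trivial
      rw [← range_thetaProj] at hp
      exact hp
    exact SheafedSpace.IsOpenImmersion.to_iso (thetaProj 𝒜)
  exact @IsIso.of_isIso_comp_left _ _ _ _ _ (multiProjIncl 𝒜).toShHom (thetaRinged 𝒜) h2 h3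

theorem exists_dSpecIso (h1 : IsRelevant 𝒜 1) :
    ∃ e : dSpecRinged 𝒜 ≅ (Spec (CommRingCat.of (𝒜 0))).toSheafedSpace,
      thetaRinged 𝒜 ≫ e.hom = (quotToSpecZero 𝒜).toShHom ∧
      ∀ (p : DSpec 𝒜) (q : PrimeSpectrum (𝒜 0)), e.hom.hom.base p = q →
        ∀ x : 𝒜 0, x ∈ q.asIdeal ↔ (x : S) ∈ p.asIdeal := by
  have := isIso_multiProjIncl h1
  have := isIso_multiProjIncl_comp h1
  have h2 : IsIso (quotToSpecZero 𝒜) := IsIso.of_isIso_comp_left (multiProjIncl 𝒜) _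
  have h3 : IsIso (quotToSpecZero 𝒜).toShHom :=
    (inferInstance : IsIso (LocallyRingedSpace.forgetToSheafedSpace.map (quotToSpecZero 𝒜)))
  have h4 := isIso_thetaRinged h1
  have he : thetaRinged 𝒜 ≫ inv (thetaRinged 𝒜) ≫ (quotToSpecZero 𝒜).toShHom =
    (quotToSpecZero 𝒜).toShHom := IsIso.hom_inv_id_assoc _ _
  refine ⟨(asIso (thetaRinged 𝒜)).symm ≪≫ asIso (quotToSpecZero 𝒜).toShHom, he, ?_⟩
  rintro p _ rfl x
  obtain ⟨P, rfl⟩ := exists_homogeneousCore_eq p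
  have hπ : quotMap 𝒜 ≫ quotToSpecZero 𝒜 =
    (Spec.map (CommRingCat.ofHom (algebraMap (𝒜 0) S))).toLRSHom := coequalizer.π_desc _ _
  have hP : (inv (thetaRinged 𝒜) ≫ (quotToSpecZero 𝒜).toShHom).hom.base (homogeneousCore 𝒜 P) =
      PrimeSpectrum.comap (algebraMap (𝒜 0) S) P := by
    rw [← theta_quotMap]
    exact (congrArg (fun g => g.hom.base ((quotMap 𝒜).base P)) he).trans
      (congrArg (fun g => g.base P) hπ)
  rw [mem_homogeneousCore 𝒜 ⟨0, x.2⟩]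
  change x ∈ ((inv (thetaRinged 𝒜) ≫ (quotToSpecZero 𝒜).toShHom).hom.base
    (homogeneousCore 𝒜 P)).asIdeal ↔ _
  rw [hP]
  rfl

end

section

variable {D S : Type u} [AddCommGroup D] [DecidableEq D] [CommRing S]
variable {𝒜 : D → AddSubgroup S} [GradedRing 𝒜]

/-! ### The open subsets `D_+(h)` -/

theorem isOpen_dPlus {h : S} (hh : SetLike.IsHomogeneousElem 𝒜 h) : IsOpen (dPlus 𝒜 h) :=
  (projD 𝒜).2.inter (isOpen_notMem 𝒜 hh)

theorem IsRelevant.mul_left {f h : S} (hf : IsRelevant 𝒜 f)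
    (hh : SetLike.IsHomogeneousElem 𝒜 h) : IsRelevant 𝒜 (h * f) :=
  mul_comm f h ▸ IsRelevant.mul 𝒜 hf hh

/-- A $D$-prime ideal not containing $S_+$ omits some generator $f$, and if it also omits $h$ it
omits $hf$. -/
theorem dPlus_eq_iUnion_span {h : S} (hh : SetLike.IsHomogeneousElem 𝒜 h) {G : Set S}
    (hG : ∀ f ∈ G, IsRelevant 𝒜 f) (hspan : Ideal.span G = irrelevantIdeal 𝒜) :
    dPlus 𝒜 h = ⋃ f ∈ G, dPlus 𝒜 (h * f) := by
  ext p
  simp only [Set.mem_iUnion, exists_prop]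
  constructor
  · rintro ⟨hp, hhp⟩
    change ¬ irrelevantIdeal 𝒜 ≤ _ at hp
    rw [← hspan, Ideal.span_le, Set.not_subset] at hp
    obtain ⟨f, hf, hfp⟩ := hp
    exact ⟨f, hf, (mem_dPlus_of_isRelevant ((hG f hf).mul_left hh)).2
      ((DSpec.mul_notMem 𝒜 hh (hG f hf).1).2 ⟨hhp, hfp⟩)⟩
  · rintro ⟨f, hf, hp, hhf⟩
    exact ⟨hp, ((DSpec.mul_notMem 𝒜 hh (hG f hf).1).1 hhf).1⟩

theorem dPlus_eq_iUnion_dvd {h : S} (hh : SetLike.IsHomogeneousElem 𝒜 h) :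
    dPlus 𝒜 h = ⋃ f ∈ {f : S | IsRelevant 𝒜 f ∧ h ∣ f}, dPlus 𝒜 f := by
  refine Set.Subset.antisymm ?_ (Set.iUnion₂_subset ?_)
  · rw [dPlus_eq_iUnion_span hh (G := {f | IsRelevant 𝒜 f}) (fun f hf => hf) rfl]
    refine Set.iUnion₂_subset fun f hf => ?_
    exact Set.subset_biUnion_of_mem (u := dPlus 𝒜) (show h * f ∈ {f | IsRelevant 𝒜 f ∧ h ∣ f} from
      ⟨IsRelevant.mul_left hf hh, dvd_mul_right h f⟩)
  · rintro f ⟨-, hf⟩ p hp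
    exact ⟨hp.1, fun h' => hp.2 (p.asIdeal.mem_of_dvd hf h')⟩

theorem theta_preimage_dPlus {h : S} (hh : SetLike.IsHomogeneousElem 𝒜 h) :
    theta 𝒜 ⁻¹' dPlus 𝒜 h = ⋃ f ∈ {f : S | IsRelevant 𝒜 f ∧ h ∣ f}, chartSet 𝒜 f := by
  rw [dPlus_eq_iUnion_dvd hh, Set.preimage_iUnion₂]
  refine Set.iUnion₂_congr fun f hf => ?_
  rw [chartSet_eq 𝒜 hf.1.1]
  exact Set.ext fun z => mem_dPlus_of_isRelevant hf.1

end

end MultigradedProj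

end

/-! ### Assembly of the theorem -/

open MultigradedProj in
theorem mainTheorem10 {D S : Type u} [AddCommGroup D] [AddGroup.FG D] [DecidableEq D]
    [CommRing S] [IsDomain S] (𝒜 : D → AddSubgroup S) [GradedRing 𝒜]
    (heff : IsEffective 𝒜) (hfact : IsFactoriallyGraded 𝒜) :
    -- `θ` restricts to an isomorphism `Proj^D(S) ≅ Proj_D(S)`
    (∃ e : (multiProj 𝒜).toSheafedSpace ≅ projDRinged 𝒜,
      e.hom ≫ projDIncl 𝒜 = (multiProjIncl 𝒜).toShHom ≫ thetaRinged 𝒜) ∧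
    -- (a)
    ((Finite D ∨ IsRelevant 𝒜 1) →
      IsIso (multiProjIncl 𝒜 ≫ quotToSpecZero 𝒜) ∧
      projD 𝒜 = ⊤ ∧
      ∃ e : dSpecRinged 𝒜 ≅ (Spec (CommRingCat.of (𝒜 0))).toSheafedSpace,
        thetaRinged 𝒜 ≫ e.hom = (quotToSpecZero 𝒜).toShHom ∧
        ∀ (p : DSpec 𝒜) (q : PrimeSpectrum (𝒜 0)), e.hom.hom.base p = q →
          ∀ x : 𝒜 0, x ∈ q.asIdeal ↔ (x : S) ∈ p.asIdeal) ∧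
    -- (b)
    (∃ (X : Scheme.{u}) (i : X.toLocallyRingedSpace ≅ multiProj 𝒜)
      (c : ∀ f : S, IsRelevant 𝒜 f →
        (Spec (CommRingCat.of (HomogeneousLocalization.Away 𝒜 f)) ⟶ X)),
      (∀ (f : S) (hf : IsRelevant 𝒜 f),
        IsOpenImmersion (c f hf) ∧
        IsChart 𝒜 f ((c f hf).toLRSHom ≫ i.hom) ∧
        Set.range ((c f hf).toLRSHom ≫ i.hom ≫ multiProjIncl 𝒜).base = chartSet 𝒜 f ∧
        ∀ (q : PrimeSpectrum (HomogeneousLocalization.Away 𝒜 f)) (p : DSpec 𝒜),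
          theta 𝒜 (((c f hf).toLRSHom ≫ i.hom ≫ multiProjIncl 𝒜).base q) = p ↔
            p ∈ dPlus 𝒜 f ∧ q.asIdeal = psiIdeal 𝒜 f p) ∧
      (∀ x : X, ∃ (f : S) (hf : IsRelevant 𝒜 f), x ∈ Set.range (c f hf)) ∧
      ∀ (f g : S) (hf : IsRelevant 𝒜 f) (hg : IsRelevant 𝒜 g),
        ∃ hfg : IsRelevant 𝒜 (f * g),
          Set.range (c f hf) ∩ Set.range (c g hg) = Set.range (c (f * g) hfg) ∧
          chartSet 𝒜 f ∩ chartSet 𝒜 g = chartSet 𝒜 (f * g) ∧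
          dPlus 𝒜 f ∩ dPlus 𝒜 g = dPlus 𝒜 (f * g) ∧
          Spec.map (CommRingCat.ofHom (awayMapLeft 𝒜 f hg.1)) ≫ c f hf = c (f * g) hfg ∧
          Spec.map (CommRingCat.ofHom (awayMapRight 𝒜 g hf.1)) ≫ c g hg = c (f * g) hfg ∧
          IsPullback (Spec.map (CommRingCat.ofHom (awayMapLeft 𝒜 f hg.1)))
            (Spec.map (CommRingCat.ofHom (awayMapRight 𝒜 g hf.1))) (c f hf) (c g hg)) ∧
    -- (c)
    (∀ h : S, SetLike.IsHomogeneousElem 𝒜 h →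
      IsOpen (dPlus 𝒜 h) ∧
      (dPlus 𝒜 h = ⋃ f ∈ {f : S | IsRelevant 𝒜 f ∧ h ∣ f}, dPlus 𝒜 f) ∧
      (theta 𝒜 ⁻¹' dPlus 𝒜 h = ⋃ f ∈ {f : S | IsRelevant 𝒜 f ∧ h ∣ f}, chartSet 𝒜 f) ∧
      ∀ G : Set S, (∀ f ∈ G, IsRelevant 𝒜 f) → Ideal.span G = irrelevantIdeal 𝒜 →
        (∀ f ∈ G, IsRelevant 𝒜 (h * f)) ∧
        dPlus 𝒜 h = ⋃ f ∈ G, dPlus 𝒜 (h * f)) := by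
  refine ⟨exists_thetaIso 𝒜, fun h => ?_, ?_, fun h hh => ?_⟩
  · have h1 : IsRelevant 𝒜 1 := h.elim (fun _ => isRelevant_one_of_finite) id
    exact ⟨isIso_multiProjIncl_comp h1, projD_eq_top h1, exists_dSpecIso h1⟩
  · refine ⟨multiProjScheme 𝒜, Iso.refl _, fun f hf => chartHom hf, fun f hf => ?_,
      exists_mem_range_chartHom, fun f g hf hg => ?_⟩
    · refine ⟨inferInstance, ?_, ?_, theta_chart_eq_iff hf⟩
      · exact (Category.comp_id (chart 𝒜 hf)).symm ▸ isChart_chart 𝒜 hf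
      · exact range_chart_comp 𝒜 hf
    · have hfg := IsRelevant.mul 𝒜 hf hg.1
      have hl := spec_awayMap_comp_chartHom hf hfg hg.1.choose_spec rfl
      have hr := spec_awayMap_comp_chartHom hg hfg hf.1.choose_spec (mul_comm f g)
      have hinter := range_chartHom_inter hf hg hfg
      exact ⟨hfg, hinter, chartSet_inter hf.1 hg.1, dPlus_inter hf.1 hg.1, hl, hr,
        isPullback_of_range_inter hl hr hinter⟩
  · exact ⟨isOpen_dPlus hh, dPlus_eq_iUnion_dvd hh, theta_preimage_dPlus hh, fun G hG hspan =>
      ⟨fun f hf => (hG f hf).mul_left hh, dPlus_eq_iUnion_span hh hG hspan⟩⟩
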